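/- Let $T>0$, $n\ge 1$, and let $(\xi_k)_{k\ge1}$ be independent, identically distributed real random variables with $E(\xi_1)=0$ and $\mathrm{Var}(\xi_1)=1$. For $\varepsilon>0$ and $s\ge 0$ put $$\theta_\varepsilon(s)=\frac1\varepsilon\sum_{k=1}^\infty \xi_k\,\mathbf 1_{[k-1,k)}\!\left(\frac{s}{\varepsilon^2}\right),\qquad \eta_\varepsilon(t)=\int_0^t\theta_\varepsilon(s)\,ds,$$ and for $f\in L^2([0,T]^n)$ and $t\in[0,T]$ let $$Y^f_{\eta_\varepsilon}(t)=\int_{[0,t]^n} f(x_1,\dots,x_n)\prod_{i=1}^n\theta_\varepsilon(x_i)\prod_{\substack{i,j=1\\ i\ne j}}^n \mathbf 1_{\{|x_i-x_j|>\varepsilon\}}\,dx_1\cdots dx_n .$$ Then, for every $f\in L^2([0,T]^n)$: (1) for all $0<\varepsilon\le 1$ and all $t\in[0,T]$, the random variable $Y^f_{\eta_\varepsilon}(t)$ is square integrable and $$E\big[Y^f_{\eta_\varepsilon}(t)^2\big]\le n!\,\|f\|^2_{L^2([0,T]^n)};$$ (2) let $W$ be a standard Brownian motion (on a possibly different probability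 space), and let $I_n(g)$ denote the multiple Wiener–Itô integral of $g\in L^2([0,T]^n)$ with respect to $W$, that is, the $L^2$-limit of $I_n(g_k)$ along functions $g_k\to g$ in $L^2([0,T]^n)$ of the form $\sum_l\alpha_l\mathbf 1_{(a_l^1,b_l^1]\times\cdots\times(a_l^n,b_l^n]}$ with $0\le a_l^i\le b_l^i\le T$ and with $[a_l^1,b_l^1],\dots,[a_l^n,b_l^n]$ pairwise disjoint for each $l$, for which $I_n$ is $\sum_l\alpha_l\prod_{i=1}^n\big(W(b_l^i)-W(a_l^i)\big)$. Then $I_n(f\,\mathbf 1_{[0,t]^n})$ exists for every $t\in[0,T]$, and, as $\varepsilon\downarrow0$, the finite-dimensional distributions of $(Y^f_{\eta_\varepsilon}(t))_{t\in[0,T]}$ converge in law to those of $(I_n(f\,\mathbf 1_{[0,t]^n}))_{t\in[0,T]}$. -/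

import Mathlib

open MeasureTheory ProbabilityTheory Filter Set
open scoped NNReal ENNReal Topology Nat

noncomputable section

namespace DonskerWiener

variable {Ω : Type*}

/-- The cube `[0,t]^n`. -/
def cube (n : ℕ) (t : ℝ≥0) : Set (Fin n → ℝ) :=
  Set.univ.pi fun _ => Set.Icc (0 : ℝ) (t : ℝ)

/-- The Donsker kernel `θ_ε(s) = ε⁻¹ ∑_{k ≥ 1} ξ_k 1_{[k-1,k)}(s / ε²)`. The sequence is indexed
from `0`, so that `ξ k` here plays the role of `ξ_{k+1}`. For each `s` at most one summand is
nonzero. -/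
def donskerKernel (ξ : ℕ → Ω → ℝ) (ε : ℝ) (s : ℝ) (ω : Ω) : ℝ :=
  ε⁻¹ * ∑' k : ℕ, ξ k ω * (Set.Ico (k : ℝ) ((k : ℝ) + 1)).indicator (fun _ => (1 : ℝ)) (s / ε ^ 2)

/-- For a process `θ = η'`, the multiple integral with the diagonals removed,
`Y^f_η(t) = ∫_{[0,t]^n} f(x) ∏_i θ(x_i) ∏_{i ≠ j} 1_{|x_i - x_j| > ε} dx`. -/
def truncatedIntegral {n : ℕ} (θ : ℝ → Ω → ℝ) (ε : ℝ) (f : (Fin n → ℝ) → ℝ) (t : ℝ≥0) (ω : Ω) :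
    ℝ :=
  ∫ x in cube n t, f x * (∏ i, θ (x i) ω) *
    ∏ p ∈ (Finset.univ : Finset (Fin n)).offDiag, (if ε < |x p.1 - x p.2| then (1 : ℝ) else 0)

/-- A box `(a¹,b¹] × ⋯ × (aⁿ,bⁿ]` in `[0,T]^n` whose closed sides are pairwise disjoint. -/
structure OffDiagBox (n : ℕ) (T : ℝ≥0) where
  lo : Fin n → ℝ≥0
  hi : Fin n → ℝ≥0
  lo_le_hi : ∀ i, lo i ≤ hi i
  hi_le : ∀ i, hi i ≤ T
  disjoint : ∀ i j, i ≠ j → Disjoint (Set.Icc (lo i) (hi i)) (Set.Icc (lo j) (hi j))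

/-- The subset of `ℝⁿ` underlying a box. -/
def OffDiagBox.toSet {n : ℕ} {T : ℝ≥0} (B : OffDiagBox n T) : Set (Fin n → ℝ) :=
  Set.univ.pi fun i => Set.Ioc (B.lo i : ℝ) (B.hi i : ℝ)

/-- A simple function `∑_k α_k 1_{Δ_k}` on `[0,T]^n`, given by its coefficients `α_k` and
off-diagonal boxes `Δ_k`. -/
structure OffDiagSimple (n : ℕ) (T : ℝ≥0) where
  m : ℕ
  coeff : Fin m → ℝ
  box : Fin m → OffDiagBox n T

/-- The function `∑_k α_k 1_{Δ_k}`. -/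
def OffDiagSimple.eval {n : ℕ} {T : ℝ≥0} (g : OffDiagSimple n T) (x : Fin n → ℝ) : ℝ :=
  ∑ k, g.coeff k * (g.box k).toSet.indicator (fun _ => (1 : ℝ)) x

/-- The multiple Wiener–Itô integral of a simple function,
`∑_k α_k ∏_i (W(b_k^i) - W(a_k^i))`. -/
def OffDiagSimple.integral {n : ℕ} {T : ℝ≥0} (g : OffDiagSimple n T) (W : ℝ≥0 → Ω → ℝ) (ω : Ω) :
    ℝ :=
  ∑ k, g.coeff k * ∏ i, (W ((g.box k).hi i) ω - W ((g.box k).lo i) ω)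

/-- `I` is (a version of) the multiple Wiener–Itô integral `I_n(f)` of `f ∈ L²([0,T]^n)` with
respect to `W`: it is the limit in `L²(Ω)` of the integrals of off-diagonal simple functions which
converge to `f` in `L²([0,T]^n)`. -/
def IsMultipleWienerIntegral [MeasurableSpace Ω] {n : ℕ} (W : ℝ≥0 → Ω → ℝ) (P : Measure Ω)
    (T : ℝ≥0) (f : (Fin n → ℝ) → ℝ) (I : Ω → ℝ) : Prop :=
  MemLp I 2 P ∧ ∃ g : ℕ → OffDiagSimple n T,
    Tendsto (fun k => eLpNorm (fun x => (g k).eval x - f x) 2 (volume.restrict (cube n T)))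
      atTop (𝓝 0) ∧
    Tendsto (fun k => eLpNorm (fun ω => (g k).integral W ω - I ω) 2 P) atTop (𝓝 0)

end DonskerWiener

end

/-! The kernel `θ_ε` is constant on blocks of length `ε²`, so `Y` is a polynomial in finitely many
`ξ_k`. Its coefficient at a multi-index is the inner product of `f * separated ε` with a normalized
product of blocks (`truncatedIntegral_eq_sum`). If two indices agree, two coordinates share a block
and are within `ε² ≤ ε` of each other, so the truncation kills the coefficient. The surviving
monomials are orthonormal, except that up to `n!` multi-indices give the same one. With Bessel's
inequality for the block products this yields the second moment bound, uniformly in `ε` and `t`.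

For the convergence, let `g` be an off-diagonal simple function. Once `ε` is smaller than all gaps
between sides, the truncation is invisible and `Y^g` is a fixed polynomial in increments of the
interpolated random walk. Donsker's theorem for finite-dimensional distributions
(`tendstoInDistribution_donskerWalk`, by characteristic functions) and continuous mapping give
convergence to `I_n(g)`. Fatou's lemma carries the moment bound to the limit, `E[I_n(g)²] ≤ n!
‖g‖²`, which takes the place of the Itô isometry. Since such `g` are dense and `L²` is complete,
`I_n` exists.

Finally, replacing `f` by `g` costs a multiple of `‖f - g‖` in mean, uniformly in `ε`, so
convergence passes from `g` to `f` (`tendstoInDistribution_of_forall_approx`). -/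

noncomputable section

namespace DonskerWiener

/-! ### Characteristic functions of triangular arrays; sums giving the covariance of the walk. -/

section TriangularArrays

/-- Factors are exchanged one at a time; the untouched ones lie in the unit disc. -/
theorem norm_prod_sub_prod_le {ι : Type*} (s : Finset ι) (u v : ι → ℂ)
    (hu : ∀ i, ‖u i‖ ≤ 1) (hv : ∀ i, ‖v i‖ ≤ 1) :
    ‖∏ i ∈ s, u i - ∏ i ∈ s, v i‖ ≤ ∑ i ∈ s, ‖u i - v i‖ := by
  classical
  induction s using Finset.induction_on with
  | empty => simp
  | insert a s ha ih =>
    rw [Finset.prod_insert ha, Finset.prod_insert ha, Finset.sum_insert ha]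
    have hP : ‖∏ i ∈ s, u i‖ ≤ 1 := by
      rw [norm_prod]
      exact Finset.prod_le_one (fun _ _ => norm_nonneg _) fun i _ => hu i
    calc ‖u a * ∏ i ∈ s, u i - v a * ∏ i ∈ s, v i‖
        = ‖(u a - v a) * ∏ i ∈ s, u i + v a * (∏ i ∈ s, u i - ∏ i ∈ s, v i)‖ := by ring_nf
      _ ≤ ‖u a - v a‖ * ‖∏ i ∈ s, u i‖ + ‖v a‖ * ‖∏ i ∈ s, u i - ∏ i ∈ s, v i‖ :=
          (norm_add_le _ _).trans (by rw [norm_mul, norm_mul])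
      _ ≤ ‖u a - v a‖ * 1 + 1 * ∑ i ∈ s, ‖u i - v i‖ := by
          gcongr
          exact hv a
      _ = _ := by ring

/-- The Gaussian characteristic function has the same second-order Taylor polynomial as that of any
standardized variable, so the two differ by `o(t²)`. -/
theorem isLittleO_exp_neg_sq_half :
    (fun t : ℝ => Complex.exp (-(t : ℂ) ^ 2 / 2) - (1 - (t : ℂ) ^ 2 / 2)) =o[𝓝 0]
      fun t : ℝ => t ^ 2 := by
  have h := (Complex.hasDerivAt_exp 0).isLittleO
  have h2 : Tendsto (fun t : ℝ => -(t : ℂ) ^ 2 / 2) (𝓝 0) (𝓝 0) := by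
    have : Continuous fun t : ℝ => -(t : ℂ) ^ 2 / 2 := by fun_prop
    simpa using this.tendsto 0
  have h3 := h.comp_tendsto h2
  have h4 : (fun t : ℝ => Complex.exp (-(t : ℂ) ^ 2 / 2) - (1 - (t : ℂ) ^ 2 / 2)) =o[𝓝 0]
      fun t : ℝ => -(t : ℂ) ^ 2 / 2 := by
    refine h3.congr (fun t => ?_) (fun t => ?_)
    · simp; ring
    · simp
  refine h4.trans_isBigO (Asymptotics.IsBigO.of_bound 1 (Eventually.of_forall fun t => ?_))
  simp
  nlinarith [sq_nonneg t]

/-- The central limit theorem for triangular arrays of multiples of one random variable, at the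
level of characteristic functions. -/
theorem tendsto_prod_of_isLittleO {α : Type*} {l : Filter α} {χ : ℝ → ℂ}
    (hχ : ∀ t, ‖χ t‖ ≤ 1)
    (hχ2 : (fun t : ℝ => χ t - (1 - (t : ℂ) ^ 2 / 2)) =o[𝓝 0] fun t : ℝ => t ^ 2)
    {N : α → ℕ} {a : α → ℕ → ℝ} {m : α → ℝ} (hm : Tendsto m l (𝓝 0))
    (ham : ∀ᶠ x in l, ∀ k, |a x k| ≤ m x) {v : ℝ}
    (hv : Tendsto (fun x => ∑ k ∈ Finset.range (N x), a x k ^ 2) l (𝓝 v)) :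
    Tendsto (fun x => ∏ k ∈ Finset.range (N x), χ (a x k)) l (𝓝 (Complex.exp (-(v : ℂ) / 2))) := by
  have hdiff : (fun t : ℝ => χ t - Complex.exp (-(t : ℂ) ^ 2 / 2)) =o[𝓝 0] fun t : ℝ => t ^ 2 :=
    (hχ2.sub isLittleO_exp_neg_sq_half).congr_left fun t => by ring
  have hexp : ∀ t : ℝ, ‖Complex.exp (-(t : ℂ) ^ 2 / 2)‖ ≤ 1 := fun t => by
    rw [Complex.norm_exp]
    have : (-(t : ℂ) ^ 2 / 2).re = -t ^ 2 / 2 := by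
      rw [show (-(t : ℂ) ^ 2 / 2) = ((-t ^ 2 / 2 : ℝ) : ℂ) by push_cast; ring, Complex.ofReal_re]
    rw [this, Real.exp_le_one_iff]
    nlinarith [sq_nonneg t]
  have h1 : Tendsto (fun x => ∏ k ∈ Finset.range (N x), Complex.exp (-(a x k : ℂ) ^ 2 / 2)) l
      (𝓝 (Complex.exp (-(v : ℂ) / 2))) := by
    have h2 : Tendsto (fun x => Complex.exp
        (-((∑ k ∈ Finset.range (N x), a x k ^ 2 : ℝ) : ℂ) / 2)) l
        (𝓝 (Complex.exp (-(v : ℂ) / 2))) :=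
      ((by fun_prop : Continuous fun y : ℝ => Complex.exp (-(y : ℂ) / 2)).tendsto v).comp hv
    refine h2.congr fun x => ?_
    rw [← Complex.exp_sum]
    congr 1
    push_cast
    rw [← Finset.sum_neg_distrib, Finset.sum_div]
  have h2 : Tendsto (fun x => ∏ k ∈ Finset.range (N x), χ (a x k)
      - ∏ k ∈ Finset.range (N x), Complex.exp (-(a x k : ℂ) ^ 2 / 2)) l (𝓝 0) := by
    rw [Metric.tendsto_nhds]
    intro δ hδ
    have hv0 : (0 : ℝ) < |v| + 1 := by positivity
    -- Eventually `∑ a² < |v| + 1`, so termwise errors `δ / (2 (|v| + 1)) * a²` add up to at most `δ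
    -- / 2`.
    obtain ⟨ρ, hρ, hρ'⟩ := Metric.eventually_nhds_iff.1
      (hdiff.bound (show (0 : ℝ) < δ / (2 * (|v| + 1)) by positivity))
    filter_upwards [hm.eventually (gt_mem_nhds hρ), ham,
      hv.eventually (gt_mem_nhds (show v < |v| + 1 from (le_abs_self v).trans_lt (lt_add_one _)))]
      with x hx1 hx2 hx3
    rw [dist_zero_right]
    refine (norm_prod_sub_prod_le _ _ _ (fun _ => hχ _) (fun _ => hexp _)).trans_lt ?_
    calc ∑ k ∈ Finset.range (N x), ‖χ (a x k) - Complex.exp (-(a x k : ℂ) ^ 2 / 2)‖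
        ≤ ∑ k ∈ Finset.range (N x), δ / (2 * (|v| + 1)) * a x k ^ 2 := by
          refine Finset.sum_le_sum fun k _ => ?_
          have := @hρ' (a x k) (by rw [dist_zero_right]; exact (hx2 k).trans_lt hx1)
          simpa using this
      _ = δ / (2 * (|v| + 1)) * ∑ k ∈ Finset.range (N x), a x k ^ 2 := by rw [Finset.mul_sum]
      _ ≤ δ / (2 * (|v| + 1)) * (|v| + 1) := by gcongr
      _ = δ / 2 := by field_simp
      _ < δ := half_lt_self hδ
  simpa using h2.add h1

/-- The truncation of `x` to `[0,1]`. -/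
def clamp (x : ℝ) : ℝ := max 0 (min 1 x)

theorem clamp_nonneg (x : ℝ) : 0 ≤ clamp x := le_max_left _ _

theorem clamp_le_one (x : ℝ) : clamp x ≤ 1 := max_le zero_le_one (min_le_left _ _)

theorem clamp_mono : Monotone clamp := fun _ _ h => max_le_max le_rfl (min_le_min le_rfl h)

theorem clamp_of_nonpos {x : ℝ} (h : x ≤ 0) : clamp x = 0 := by
  rw [clamp, max_eq_left ((min_le_right _ _).trans h)]

theorem clamp_of_one_le {x : ℝ} (h : 1 ≤ x) : clamp x = 1 := by
  rw [clamp, min_eq_left h, max_eq_right zero_le_one]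

/-- `clamp (u - k)` is the length of the part of `[k, k+1)` to the left of `u`. -/
theorem sum_clamp_sub (N : ℕ) {u : ℝ} (hu : 0 ≤ u) :
    ∑ k ∈ Finset.range N, clamp (u - k) = min u N := by
  induction N with
  | zero => simp [hu]
  | succ N ih =>
    rw [Finset.sum_range_succ, ih]
    push_cast
    rcases le_total u N with h | h
    · rw [min_eq_left h, clamp_of_nonpos (by linarith), min_eq_left (by linarith), add_zero]
    · rcases le_total u (N + 1) with h' | h'
      · rw [min_eq_right h, min_eq_left h', clamp, min_eq_right (by linarith),
          max_eq_right (by linarith)]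
        ring
      · rw [min_eq_right h, min_eq_right h', clamp_of_one_le (by linarith)]

/-- Only the cell containing `u`, `k = ⌊u⌋`, is cut properly; every other term is `0`. -/
theorem sum_clamp_mul_one_sub_clamp_le (N : ℕ) {u : ℝ} (hu : 0 ≤ u) :
    ∑ k ∈ Finset.range N, clamp (u - k) * (1 - clamp (u - k)) ≤ 1 := by
  calc ∑ k ∈ Finset.range N, clamp (u - k) * (1 - clamp (u - k))
      ≤ ∑ k ∈ Finset.range N, if k = ⌊u⌋₊ then (1 : ℝ) else 0 := by
        refine Finset.sum_le_sum fun k _ => ?_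
        split_ifs with h
        · nlinarith [clamp_nonneg (u - k), clamp_le_one (u - k)]
        · rcases lt_or_gt_of_ne h with h | h
          · have : (k : ℝ) + 1 ≤ u := by
              have := (Nat.le_floor_iff hu).1 (Nat.succ_le_of_lt h)
              exact_mod_cast this
            rw [clamp_of_one_le (by linarith)]; simp
          · rw [clamp_of_nonpos (by linarith [(Nat.floor_lt hu).1 h])]; simp
    _ ≤ 1 := by
        rw [Finset.sum_ite_eq']
        split_ifs <;> norm_num

/-- This is the covariance of the rescaled walk at times `u ≤ v`. It equals `min u v` up to the
error from the cell of `u`, which is negligible after multiplication by `ε²`. -/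
theorem abs_sum_clamp_mul_clamp_sub_le (N : ℕ) {u v : ℝ} (hu : 0 ≤ u) (huv : u ≤ v)
    (huN : u ≤ N) :
    |∑ k ∈ Finset.range N, clamp (u - k) * clamp (v - k) - u| ≤ 1 := by
  have h1 : ∑ k ∈ Finset.range N, clamp (u - k) * clamp (v - k) - u =
      -∑ k ∈ Finset.range N, clamp (u - k) * (1 - clamp (v - k)) := by
    have := sum_clamp_sub N hu
    rw [min_eq_left huN] at this
    nth_rewrite 2 [← this]
    rw [← Finset.sum_sub_distrib, ← Finset.sum_neg_distrib]
    exact Finset.sum_congr rfl fun k _ => by ring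
  rw [h1, abs_neg, abs_of_nonneg]
  · refine (Finset.sum_le_sum fun k _ => ?_).trans (sum_clamp_mul_one_sub_clamp_le N hu)
    have h2 : clamp (u - k) ≤ clamp (v - k) := clamp_mono (by linarith)
    exact mul_le_mul_of_nonneg_left (by linarith) (clamp_nonneg _)
  · exact Finset.sum_nonneg fun k _ =>
      mul_nonneg (clamp_nonneg _) (by linarith [clamp_le_one (v - k)])

end TriangularArrays

/-! ### The Donsker kernel and the interpolated random walk. -/

section Kernel

variable {Ω : Type*}

/-- The indicator function of the block `[kε², (k+1)ε²)`. -/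
def block (ε : ℝ) (k : ℕ) (s : ℝ) : ℝ :=
  (Set.Ico (k : ℝ) ((k : ℝ) + 1)).indicator (fun _ => (1 : ℝ)) (s / ε ^ 2)

theorem measurable_block (ε : ℝ) (k : ℕ) : Measurable (block ε k) :=
  (measurable_const.indicator measurableSet_Ico).comp (measurable_id.div_const _)

theorem block_nonneg (ε : ℝ) (k : ℕ) (s : ℝ) : 0 ≤ block ε k s :=
  Set.indicator_nonneg (fun _ _ => zero_le_one) _

theorem block_le_one (ε : ℝ) (k : ℕ) (s : ℝ) : block ε k s ≤ 1 :=
  Set.indicator_le_self' (f := fun _ => (1 : ℝ)) (fun _ _ => zero_le_one) _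

theorem block_eq_one_iff {ε : ℝ} {k : ℕ} {s : ℝ} :
    block ε k s = 1 ↔ (k : ℝ) ≤ s / ε ^ 2 ∧ s / ε ^ 2 < k + 1 := by
  unfold block
  by_cases h : s / ε ^ 2 ∈ Set.Ico (k : ℝ) (k + 1)
  · simp [h, ← Set.mem_Ico]
  · simp only [Set.indicator_of_notMem h, zero_ne_one, false_iff]
    exact h

theorem block_eq_zero_or_one (ε : ℝ) (k : ℕ) (s : ℝ) : block ε k s = 0 ∨ block ε k s = 1 := by
  unfold block
  by_cases h : s / ε ^ 2 ∈ Set.Ico (k : ℝ) (k + 1)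
  · right; simp [h]
  · left; simp [h]

theorem block_mul_block_of_ne (ε : ℝ) {k l : ℕ} (h : k ≠ l) (s : ℝ) :
    block ε k s * block ε l s = 0 := by
  rcases block_eq_zero_or_one ε k s with hk | hk
  · simp [hk]
  rcases block_eq_zero_or_one ε l s with hl | hl
  · simp [hl]
  rw [block_eq_one_iff] at hk hl
  exfalso
  have h1 : (k : ℝ) < (l + 1 : ℕ) := by push_cast; linarith
  have h2 : (l : ℝ) < (k + 1 : ℕ) := by push_cast; linarith
  rw [Nat.cast_lt] at h1 h2
  omega

theorem block_eq_indicator {ε : ℝ} (hε : 0 < ε) (k : ℕ) :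
    block ε k = (Set.Ico (k * ε ^ 2) ((k + 1) * ε ^ 2)).indicator fun _ => (1 : ℝ) := by
  ext s
  unfold block Set.indicator
  have : (0 : ℝ) < ε ^ 2 := by positivity
  simp only [Set.mem_Ico, le_div_iff₀ this, div_lt_iff₀ this]

/-- The cutoff `N` is left free so that one value serves all times up to a given bound. -/
theorem donskerKernel_eq_sum (ξ : ℕ → Ω → ℝ) {ε s : ℝ} {N : ℕ} (hN : s / ε ^ 2 < N) (ω : Ω) :
    donskerKernel ξ ε s ω = ∑ k ∈ Finset.range N, ξ k ω * (ε⁻¹ * block ε k s) := by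
  unfold donskerKernel
  rw [tsum_eq_sum (s := Finset.range N), Finset.mul_sum]
  · exact Finset.sum_congr rfl fun k _ => by unfold block; ring
  · intro k hk
    rw [Set.indicator_of_notMem, mul_zero]
    intro h
    rw [Finset.mem_range, not_lt] at hk
    have : (N : ℝ) ≤ k := by exact_mod_cast hk
    linarith [h.1]

theorem intervalIntegrable_block (ε : ℝ) (k : ℕ) (a b : ℝ) :
    IntervalIntegrable (block ε k) volume a b := by
  refine (intervalIntegrable_const (c := (1 : ℝ))).mono_fun'
    (measurable_block ε k).aestronglyMeasurable (Eventually.of_forall fun x => ?_)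
  exact (Real.norm_of_nonneg (block_nonneg ε k x)).trans_le (block_le_one ε k x)

theorem integral_block {ε : ℝ} (hε : 0 < ε) (k : ℕ) {s : ℝ} (hs : 0 ≤ s) :
    ∫ x in (0 : ℝ)..s, block ε k x = ε ^ 2 * clamp (s / ε ^ 2 - k) := by
  have hε2 : (0 : ℝ) < ε ^ 2 := by positivity
  rw [intervalIntegral.integral_of_le hs, ← integral_Ico_eq_integral_Ioc, block_eq_indicator hε,
    integral_indicator measurableSet_Ico, Measure.restrict_restrict measurableSet_Ico,
    Set.Ico_inter_Ico]
  simp only [integral_const, smul_eq_mul, mul_one, measureReal_restrict_apply_univ,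
    Real.volume_real_Ico]
  have h1 : (k * ε ^ 2) ⊔ (0 : ℝ) = k * ε ^ 2 := max_eq_left (by positivity)
  rw [h1, clamp, mul_max_of_nonneg _ _ hε2.le, mul_min_of_nonneg _ _ hε2.le, mul_zero, max_comm]
  congr 1
  change min ((k + 1) * ε ^ 2) s - k * ε ^ 2 = _
  rw [← min_sub_sub_right]
  congr 1
  · ring
  · field_simp

/-- The interpolated random walk `η_ε(s) = ∫₀ˢ θ_ε`. -/
def donskerWalk (ξ : ℕ → Ω → ℝ) (ε : ℝ) (s : ℝ≥0) (ω : Ω) : ℝ :=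
  ∫ x in (0 : ℝ)..s, donskerKernel ξ ε x ω

theorem intervalIntegrable_donskerKernel (ξ : ℕ → Ω → ℝ) (ε : ℝ) (a b : ℝ) (ω : Ω) :
    IntervalIntegrable (fun x => donskerKernel ξ ε x ω) volume a b := by
  obtain ⟨N, hN⟩ := exists_nat_gt (max a b / ε ^ 2)
  have : IntervalIntegrable
      (fun x => ∑ k ∈ Finset.range N, ξ k ω * (ε⁻¹ * block ε k x)) volume a b := by
    have := IntervalIntegrable.sum (Finset.range N) (f := fun k x => ξ k ω * (ε⁻¹ * block ε k x))
      fun k _ => ((intervalIntegrable_block ε k a b).const_mul _).const_mul _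
    rwa [show ∑ k ∈ Finset.range N, (fun x => ξ k ω * (ε⁻¹ * block ε k x)) =
      fun x => ∑ k ∈ Finset.range N, ξ k ω * (ε⁻¹ * block ε k x) by ext x; simp] at this
  refine this.congr fun x hx => ?_
  rw [donskerKernel_eq_sum]
  refine lt_of_le_of_lt ?_ hN
  have := hx.2
  gcongr

theorem donskerWalk_eq_sum (ξ : ℕ → Ω → ℝ) {ε : ℝ} {s : ℝ≥0} {N : ℕ} (hN : s / ε ^ 2 < N)
    (ω : Ω) :
    donskerWalk ξ ε s ω =
      ∑ k ∈ Finset.range N, ξ k ω * (ε⁻¹ * ∫ x in (0 : ℝ)..s, block ε k x) := by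
  unfold donskerWalk
  have : ∫ x in (0 : ℝ)..s, donskerKernel ξ ε x ω =
      ∫ x in (0 : ℝ)..s, ∑ k ∈ Finset.range N, ξ k ω * (ε⁻¹ * block ε k x) := by
    refine intervalIntegral.integral_congr fun x hx => ?_
    refine donskerKernel_eq_sum ξ (lt_of_le_of_lt ?_ hN) ω
    rw [Set.uIcc_of_le s.coe_nonneg] at hx
    have := hx.2
    gcongr
  rw [this, intervalIntegral.integral_finsetSum]
  · simp only [intervalIntegral.integral_const_mul]
  · exact fun k _ => ((intervalIntegrable_block ε k _ _).const_mul _).const_mul _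

theorem donskerWalk_eq_sum_clamp (ξ : ℕ → Ω → ℝ) {ε : ℝ} (hε : 0 < ε) {s : ℝ≥0} {N : ℕ}
    (hN : s / ε ^ 2 < N) (ω : Ω) :
    donskerWalk ξ ε s ω = ∑ k ∈ Finset.range N, ε * clamp (s / ε ^ 2 - k) * ξ k ω := by
  rw [donskerWalk_eq_sum ξ hN]
  refine Finset.sum_congr rfl fun k _ => ?_
  rw [integral_block hε k s.coe_nonneg]
  field_simp

/-- Stated for every real `ε`, since `TendstoInDistribution` asks for measurability at every index
and not only along the filter. -/
theorem aemeasurable_donskerWalk [MeasurableSpace Ω] {P : Measure Ω} {ξ : ℕ → Ω → ℝ}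
    (hξ : ∀ k, AEMeasurable (ξ k) P) (ε : ℝ) (s : ℝ≥0) :
    AEMeasurable (donskerWalk ξ ε s) P := by
  obtain ⟨N, hN⟩ := exists_nat_gt (s / ε ^ 2 : ℝ)
  have : donskerWalk ξ ε s =
      fun ω => ∑ k ∈ Finset.range N, ξ k ω * (ε⁻¹ * ∫ x in (0 : ℝ)..s, block ε k x) :=
    funext fun ω => donskerWalk_eq_sum ξ hN ω
  rw [this]
  exact Finset.aemeasurable_fun_sum _ fun k _ => (hξ k).mul_const _

end Kernel

/-! ### Donsker's theorem for finite-dimensional distributions. -/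

section Donsker

/-- The Cramér–Wold device: joint laws are tested through scalar linear combinations. -/
theorem charFun_map_toLp {Ω : Type*} [MeasurableSpace Ω] {P : Measure Ω} [IsProbabilityMeasure P]
    {ι : Type*} [Fintype ι] {X : ι → Ω → ℝ} (hX : ∀ i, AEMeasurable (X i) P)
    (t : EuclideanSpace ℝ ι) :
    charFun (P.map fun ω => WithLp.toLp 2 fun i => X i ω) t =
      charFun (P.map fun ω => ∑ i, t i * X i ω) 1 := by
  have h1 : AEMeasurable (fun ω => WithLp.toLp 2 fun i => X i ω : Ω → EuclideanSpace ℝ ι) P :=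
    (WithLp.measurable_toLp 2 (ι → ℝ)).comp_aemeasurable (aemeasurable_pi_lambda _ hX)
  have h2 : AEMeasurable (fun ω => ∑ i, t i * X i ω) P :=
    Finset.aemeasurable_fun_sum _ fun i _ => (hX i).const_mul _
  rw [charFun_apply, charFun_apply_real, integral_map h1 (by fun_prop), integral_map h2 (by fun_prop)]
  congr with ω
  simp [PiLp.inner_apply]

theorem charFun_sum_mul_brownian {Ω' : Type*} [MeasurableSpace Ω'] {P' : Measure Ω'}
    [IsProbabilityMeasure P'] {W : ℝ≥0 → Ω' → ℝ} (hW : IsPreBrownianReal W P')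
    {ι : Type*} [Fintype ι] (s : ι → ℝ≥0) (t : ι → ℝ) :
    charFun (P'.map fun ω => ∑ i, t i * W (s i) ω) 1 =
      Complex.exp (-((∑ i, ∑ j, t i * t j * min (s i : ℝ) (s j) : ℝ) : ℂ) / 2) := by
  have hG : IsGaussianProcess (fun i ω => t i * W (s i) ω) P' := by
    simpa using (hW.isGaussianProcess.comp_right s).smul t
  have hlaw : HasGaussianLaw (fun ω => ∑ i, t i * W (s i) ω) P' :=
    hG.hasGaussianLaw_fun_sum (I := Finset.univ)
  have hint : ∫ ω, ∑ i, t i * W (s i) ω ∂P' = 0 := by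
    rw [integral_finsetSum _ fun i _ => (hW.integrable_eval (s i)).const_mul _]
    simp [integral_const_mul, hW.integral_eval]
  have hvar : variance (fun ω => ∑ i, t i * W (s i) ω) P' =
      ∑ i, ∑ j, t i * t j * min (s i : ℝ) (s j) := by
    have hm : ∀ i, MemLp (fun ω => t i * W (s i) ω) 2 P' := fun i =>
      (hG.hasGaussianLaw_eval i).memLp_two
    rw [variance_fun_sum hm]
    refine Finset.sum_congr rfl fun i _ => Finset.sum_congr rfl fun j _ => ?_
    rw [covariance_const_mul_left, covariance_const_mul_right, hW.covariance_fun_eval]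
    push_cast
    ring
  rw [hlaw.map_eq_gaussianReal, charFun_gaussianReal]
  congr 1
  rw [hint, Real.coe_toNNReal _ (variance_nonneg _ _), hvar]
  push_cast
  ring

theorem charFun_sum_mul {Ω : Type*} [MeasurableSpace Ω] {P : Measure Ω} [IsProbabilityMeasure P]
    {ξ : ℕ → Ω → ℝ} (hindep : iIndepFun ξ P) (hident : ∀ k, IdentDistrib (ξ k) (ξ 0) P P)
    (a : ℕ → ℝ) (N : ℕ) :
    charFun (P.map fun ω => ∑ k ∈ Finset.range N, a k * ξ k ω) 1 =
      ∏ k ∈ Finset.range N, charFun (P.map (ξ 0)) (a k) := by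
  have h1 : iIndepFun (fun k ω => a k * ξ k ω) P :=
    hindep.comp (fun k x => a k * x) fun k => by fun_prop
  have hm := fun k => (hident k).aemeasurable_fst
  rw [(h1.restrict _).charFun_map_fun_finsetSum_eq_prod fun k _ => (hm k).const_mul _,
    Finset.prod_apply]
  refine Finset.prod_congr rfl fun k _ => ?_
  rw [charFun_map_mul_comp (hm k), mul_one, (hident k).map_eq]

/-- The sum of squares is the variance of `∑ t_i η_ε(s_i)`. Expanding the square leaves the pair
covariances, each within `ε²` of `min (s i) (s j)`. -/
theorem tendsto_sum_sq_clamp {ι : Type*} [Fintype ι] (s : ι → ℝ≥0) (t : ι → ℝ) {N : ℝ → ℕ}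
    (hN : ∀ ε i, s i / ε ^ 2 < N ε) :
    Tendsto (fun ε : ℝ => ∑ k ∈ Finset.range (N ε), (∑ i, t i * (ε * clamp (s i / ε ^ 2 - k))) ^ 2)
      (𝓝[>] 0) (𝓝 (∑ i, ∑ j, t i * t j * min (s i : ℝ) (s j))) := by
  have h1 : ∀ i j, Tendsto (fun ε : ℝ => ε ^ 2 * ∑ k ∈ Finset.range (N ε),
      clamp (s i / ε ^ 2 - k) * clamp (s j / ε ^ 2 - k)) (𝓝[>] 0) (𝓝 (min (s i : ℝ) (s j))) := by
    intro i j
    wlog hij : s i ≤ s j generalizing i j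
    · have := this j i (le_of_not_ge hij)
      rw [min_comm]
      simpa only [mul_comm (clamp (s j / _ - _))] using this
    rw [min_eq_left (by exact_mod_cast hij), tendsto_iff_dist_tendsto_zero]
    have h2 : Tendsto (fun ε : ℝ => ε ^ 2) (𝓝[>] 0) (𝓝 0) := by
      have : Continuous fun ε : ℝ => ε ^ 2 := by fun_prop
      simpa using (this.tendsto 0).mono_left nhdsWithin_le_nhds
    refine squeeze_zero' (Eventually.of_forall fun _ => dist_nonneg) ?_ h2
    filter_upwards [self_mem_nhdsWithin] with ε hε
    have hε2 : (0 : ℝ) < ε ^ 2 := pow_pos hε 2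
    have h3 := abs_sum_clamp_mul_clamp_sub_le (N ε) (u := s i / ε ^ 2) (v := s j / ε ^ 2)
      (by positivity) (by gcongr) (hN ε i).le
    rw [Real.dist_eq]
    calc _ = |ε ^ 2 * (∑ k ∈ Finset.range (N ε),
          clamp (s i / ε ^ 2 - k) * clamp (s j / ε ^ 2 - k) - s i / ε ^ 2)| := by
          rw [mul_sub, mul_div_cancel₀ _ hε2.ne']
      _ ≤ ε ^ 2 * 1 := by
          rw [abs_mul, abs_of_pos hε2]
          gcongr
      _ = ε ^ 2 := mul_one _
  refine (tendsto_finsetSum Finset.univ fun i _ => tendsto_finsetSum Finset.univ fun j _ =>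
    (h1 i j).const_mul (t i * t j)).congr fun ε => ?_
  calc _ = ∑ i, ∑ j, ∑ k ∈ Finset.range (N ε), t i * (ε * clamp (s i / ε ^ 2 - k)) *
        (t j * (ε * clamp (s j / ε ^ 2 - k))) := by
        refine Finset.sum_congr rfl fun i _ => Finset.sum_congr rfl fun j _ => ?_
        rw [← mul_assoc, Finset.mul_sum]
        exact Finset.sum_congr rfl fun k _ => by ring
    _ = ∑ i, ∑ k ∈ Finset.range (N ε), ∑ j, t i * (ε * clamp (s i / ε ^ 2 - k)) *
        (t j * (ε * clamp (s j / ε ^ 2 - k))) :=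
        Finset.sum_congr rfl fun i _ => Finset.sum_comm
    _ = _ := by
        rw [Finset.sum_comm]
        exact Finset.sum_congr rfl fun k _ => by rw [sq (∑ i, _), Finset.sum_mul_sum]

/-- Donsker's theorem for finite-dimensional distributions. -/
theorem tendstoInDistribution_donskerWalk {Ω : Type*} [MeasurableSpace Ω] {P : Measure Ω}
    [IsProbabilityMeasure P] {Ω' : Type*} [MeasurableSpace Ω'] {P' : Measure Ω'}
    [IsProbabilityMeasure P'] {ξ : ℕ → Ω → ℝ} (hindep : iIndepFun ξ P)
    (hident : ∀ k, IdentDistrib (ξ k) (ξ 0) P P)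
    (hmean : P[ξ 0] = 0) (hsq : P[ξ 0 ^ 2] = 1)
    {W : ℝ≥0 → Ω' → ℝ} (hW : IsPreBrownianReal W P') {ι : Type*} [Fintype ι] (s : ι → ℝ≥0) :
    TendstoInDistribution (fun (ε : ℝ) ω i => donskerWalk ξ ε (s i) ω) (𝓝[>] 0)
      (fun ω i => W (s i) ω) (fun _ => P) P' := by
  have hm := fun k => (hident k).aemeasurable_fst
  have hwm : ∀ ε i, AEMeasurable (donskerWalk ξ ε (s i)) P := fun ε i =>
    aemeasurable_donskerWalk hm ε (s i)
  have hlp : ∀ ε, AEMeasurable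
      (fun ω => WithLp.toLp 2 fun i => donskerWalk ξ ε (s i) ω : Ω → EuclideanSpace ℝ ι) P :=
    fun ε => (WithLp.measurable_toLp 2 (ι → ℝ)).comp_aemeasurable
      (aemeasurable_pi_lambda _ (hwm ε))
  have hWlp : AEMeasurable
      (fun ω => WithLp.toLp 2 fun i => W (s i) ω : Ω' → EuclideanSpace ℝ ι) P' :=
    (WithLp.measurable_toLp 2 (ι → ℝ)).comp_aemeasurable
      (aemeasurable_pi_lambda _ fun i => hW.aemeasurable (s i))
  -- A common bound for the times, so that a single cutoff `N ε` works for all of them.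
  obtain ⟨S, hS⟩ : ∃ S : ℝ≥0, ∀ i, s i ≤ S :=
    ⟨∑ i, s i, fun i => Finset.single_le_sum (fun _ _ => zero_le) (Finset.mem_univ i)⟩
  have hNex : ∀ ε : ℝ, ∃ N : ℕ, (S / ε ^ 2 : ℝ) < N := fun ε => exists_nat_gt _
  choose N hNS using hNex
  have hN : ∀ ε i, (s i : ℝ) / ε ^ 2 < N ε := fun ε i =>
    lt_of_le_of_lt (by have := hS i; gcongr) (hNS ε)
  have hchar : ∀ t : EuclideanSpace ℝ ι, Tendsto
      (fun ε => charFun (P.map fun ω => WithLp.toLp 2 fun i => donskerWalk ξ ε (s i) ω) t)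
      (𝓝[>] 0) (𝓝 (charFun (P'.map fun ω => WithLp.toLp 2 fun i => W (s i) ω) t)) := by
    intro t
    rw [charFun_map_toLp (fun i => hW.aemeasurable (s i)), charFun_sum_mul_brownian hW]
    have hlim := tendsto_prod_of_isLittleO (l := 𝓝[>] (0 : ℝ)) (χ := charFun (P.map (ξ 0)))
      (N := N) (a := fun ε k => ∑ i, t i * (ε * clamp (s i / ε ^ 2 - k)))
      (m := fun ε => ε * ∑ i, |t i|)
      (by
        have : IsProbabilityMeasure (P.map (ξ 0)) := Measure.isProbabilityMeasure_map (hm 0)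
        exact fun x => norm_charFun_le_one x) (taylor_charFun_two (hm 0) hmean hsq)
      (by
        have : Continuous fun ε : ℝ => ε * ∑ i, |t i| := by fun_prop
        simpa using (this.tendsto 0).mono_left nhdsWithin_le_nhds)
      (by
        filter_upwards [self_mem_nhdsWithin] with ε hε k
        have hε : 0 < ε := hε
        rw [Finset.mul_sum]
        refine (Finset.abs_sum_le_sum_abs _ _).trans (Finset.sum_le_sum fun i _ => ?_)
        rw [abs_mul, abs_mul, abs_of_pos hε, abs_of_nonneg (clamp_nonneg _), mul_left_comm]
        have := mul_le_mul_of_nonneg_left (clamp_le_one (s i / ε ^ 2 - k)) (abs_nonneg (t i))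
        nlinarith)
      (tendsto_sum_sq_clamp s t hN)
    refine hlim.congr' ?_
    filter_upwards [self_mem_nhdsWithin] with ε hε
    rw [charFun_map_toLp (hwm ε), ← charFun_sum_mul hindep hident]
    congr 2
    ext ω
    simp_rw [donskerWalk_eq_sum_clamp ξ hε (hN ε _) ω, Finset.sum_mul, Finset.mul_sum]
    rw [Finset.sum_comm]
    exact Finset.sum_congr rfl fun i _ => Finset.sum_congr rfl fun k _ => by ring
  have hdist : TendstoInDistribution
      (fun (ε : ℝ) ω => (WithLp.toLp 2 fun i => donskerWalk ξ ε (s i) ω : EuclideanSpace ℝ ι))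
      (𝓝[>] 0) (fun ω => WithLp.toLp 2 fun i => W (s i) ω) (fun _ => P) P' := by
    refine ⟨hlp, hWlp, ?_⟩
    -- Lévy's continuity theorem is applied along sequences, which suffice for a countably generated
    -- filter.
    refine tendsto_of_seq_tendsto fun u hu => ?_
    exact ProbabilityMeasure.tendsto_iff_tendsto_charFun.2 fun t => (hchar t).comp hu
  -- The Euclidean structure served only the inner product in the characteristic function; here it
  -- is forgotten.
  exact hdist.continuous_comp (g := fun x : EuclideanSpace ℝ ι => WithLp.ofLp x)
    (PiLp.continuous_ofLp 2 _)

end Donsker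

/-! ### Orthogonality of monomials in the `ξ_k`. -/

section Chaos

/-- Independence makes the joint law a product measure, where this is Fubini. -/
theorem integrable_prod_of_iIndepFun {Ω : Type*} [MeasurableSpace Ω] {P : Measure Ω}
    {ι : Type*} [Fintype ι] {X : ι → Ω → ℝ} (hX : iIndepFun X P) (hi : ∀ i, Integrable (X i) P) :
    Integrable (fun ω => ∏ i, X i ω) P := by
  have := hX.isProbabilityMeasure
  have hm := fun i => (hi i).aemeasurable
  have := fun i => Measure.isProbabilityMeasure_map (hm i)
  have h1 : Integrable (fun x : ι → ℝ => ∏ i, x i) (P.map fun ω i => X i ω) := by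
    rw [hX.map_fun_eq_pi_map hm]
    exact Integrable.fintype_prod (f := fun _ x => x) fun i =>
      (integrable_map_measure aestronglyMeasurable_id (hm i)).2 (hi i)
  exact (integrable_map_measure (by fun_prop) (aemeasurable_pi_lambda _ hm)).1 h1

variable {Ω : Type*} [MeasurableSpace Ω] {P : Measure Ω} {ξ : ℕ → Ω → ℝ}

theorem memLp_prod_of_iIndepFun (hindep : iIndepFun ξ P) (hL2 : ∀ k, MemLp (ξ k) 2 P)
    (A : Finset ℕ) : MemLp (fun ω => ∏ m ∈ A, ξ m ω) 2 P := by
  have hm := fun k => (hL2 k).aestronglyMeasurable.aemeasurable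
  rw [memLp_two_iff_integrable_sq
    (Finset.aemeasurable_fun_prod _ fun k _ => hm k).aestronglyMeasurable]
  have h1 : iIndepFun (fun (m : A) ω => ξ m ω ^ 2) P :=
    (hindep.precomp Subtype.val_injective).comp (fun _ x => x ^ 2) fun _ => by fun_prop
  refine (integrable_prod_of_iIndepFun h1 fun m => (hL2 m).integrable_sq).congr
    (Eventually.of_forall fun ω => ?_)
  simp only
  rw [← Finset.prod_pow, Finset.prod_coe_sort A fun m => ξ m ω ^ 2]

/-- Products of independent standardized variables over distinct finite sets are orthonormal. -/
theorem integral_prod_mul_prod (hindep : iIndepFun ξ P) (hL2 : ∀ k, MemLp (ξ k) 2 P)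
    (hmean : ∀ k, ∫ ω, ξ k ω ∂P = 0) (hsq : ∀ k, ∫ ω, ξ k ω ^ 2 ∂P = 1) (A B : Finset ℕ) :
    ∫ ω, (∏ m ∈ A, ξ m ω) * ∏ m ∈ B, ξ m ω ∂P = if A = B then 1 else 0 := by
  have hm := fun k => (hL2 k).aestronglyMeasurable.aemeasurable
  -- The index `m` contributes `x²`, `x` or `1` according to its membership in `A` and `B`. If `A ≠
  -- B`, an index in the symmetric difference contributes the mean, which is zero.
  let g : ℕ → ℝ → ℝ := fun m x => (if m ∈ A then x else 1) * (if m ∈ B then x else 1)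
  have hg : ∀ m, Measurable (g m) := fun m => by
    simp only [g]
    split_ifs <;> fun_prop
  have h1 : ∀ ω, (∏ m ∈ A, ξ m ω) * ∏ m ∈ B, ξ m ω = ∏ m : ↥(A ∪ B), g m (ξ m ω) := fun ω => by
    rw [Finset.prod_coe_sort (A ∪ B) fun m => g m (ξ m ω), Finset.prod_mul_distrib,
      Finset.prod_ite_mem, Finset.prod_ite_mem, Finset.inter_eq_right.2 Finset.subset_union_left,
      Finset.inter_eq_right.2 Finset.subset_union_right]
  simp_rw [h1]
  rw [(hindep.precomp (Subtype.val_injective (p := (· ∈ A ∪ B)))).integral_fun_prod_comp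
    (fun m => hm m) (fun m => (hg m).aestronglyMeasurable)]
  split_ifs with hAB
  · refine Finset.prod_eq_one fun m _ => ?_
    have hmA : (m : ℕ) ∈ A := by simpa [hAB] using m.2
    have hmB : (m : ℕ) ∈ B := hAB ▸ hmA
    simp only [g, hmA, hmB, if_true, ← sq]
    exact hsq m
  · obtain ⟨m, hm⟩ : ∃ m, ¬(m ∈ A ↔ m ∈ B) := by
      by_contra! h
      exact hAB (Finset.ext h)
    have hmem : m ∈ A ∪ B := by
      rw [Finset.mem_union]
      tauto
    refine Finset.prod_eq_zero (Finset.mem_univ ⟨m, hmem⟩) ?_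
    by_cases hmA : m ∈ A
    · have hmB : m ∉ B := by tauto
      simpa [g, hmA, hmB] using hmean m
    · have hmB : m ∈ B := by tauto
      simpa [g, hmA, hmB] using hmean m

/-- Injective tuples with the same image differ by a permutation of the positions. -/
theorem card_filter_image_eq_le {n : ℕ} (S : Finset (Fin n → ℕ)) (A : Finset ℕ) :
    (S.filter fun k => Function.Injective k ∧ Finset.univ.image k = A).card ≤ n ! := by
  classical
  rcases (S.filter fun k => Function.Injective k ∧ Finset.univ.image k = A).eq_empty_or_nonempty
    with h | ⟨k₀, hk₀⟩
  · simp [h]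
  · simp only [Finset.mem_filter] at hk₀
    obtain ⟨-, hinj, him⟩ := hk₀
    have hsub : (S.filter fun k => Function.Injective k ∧ Finset.univ.image k = A) ⊆
        Finset.univ.image fun σ : Equiv.Perm (Fin n) => k₀ ∘ σ := by
      intro k hk
      simp only [Finset.mem_filter] at hk
      obtain ⟨-, hk, hkA⟩ := hk
      have hex : ∀ i, ∃ j, k₀ j = k i := fun i => by
        have : k i ∈ Finset.univ.image k₀ := by
          rw [him, ← hkA]
          exact Finset.mem_image_of_mem k (Finset.mem_univ i)
        simpa using this
      choose τ hτ using hex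
      have hτinj : Function.Injective τ := fun i j hij => hk (by rw [← hτ i, ← hτ j, hij])
      refine Finset.mem_image.2
        ⟨Equiv.ofBijective τ (Finite.injective_iff_bijective.1 hτinj), Finset.mem_univ _, ?_⟩
      ext i
      exact hτ i
    refine (Finset.card_le_card hsub).trans (Finset.card_image_le.trans ?_)
    simp [Fintype.card_perm]

/-- The second moment of a homogeneous polynomial without diagonal terms in independent
standardized variables. -/
theorem memLp_and_integral_sq_sum_le (hindep : iIndepFun ξ P) (hL2 : ∀ k, MemLp (ξ k) 2 P)
    (hmean : ∀ k, ∫ ω, ξ k ω ∂P = 0) (hsq : ∀ k, ∫ ω, ξ k ω ^ 2 ∂P = 1) {n : ℕ}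
    (S : Finset (Fin n → ℕ)) (c : (Fin n → ℕ) → ℝ) (hc : ∀ k, ¬ Function.Injective k → c k = 0) :
    MemLp (fun ω => ∑ k ∈ S, c k * ∏ i, ξ (k i) ω) 2 P ∧
      ∫ ω, (∑ k ∈ S, c k * ∏ i, ξ (k i) ω) ^ 2 ∂P ≤ (n ! : ℝ) * ∑ k ∈ S, c k ^ 2 := by
  classical
  -- An injective multi-index may be replaced by its image set; the others have coefficient zero.
  have hrew : ∀ k ω, c k * ∏ i, ξ (k i) ω = c k * ∏ m ∈ Finset.univ.image k, ξ m ω := by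
    intro k ω
    by_cases hk : Function.Injective k
    · rw [Finset.prod_image hk.injOn]
    · simp [hc k hk]
  simp_rw [hrew]
  have hM := fun k : Fin n → ℕ => memLp_prod_of_iIndepFun hindep hL2 (Finset.univ.image k)
  refine ⟨memLp_finsetSum _ fun k _ => (hM k).const_mul (c k), ?_⟩
  have hint : ∀ k l, Integrable (fun ω => c k * c l * ((∏ m ∈ Finset.univ.image k, ξ m ω) *
      ∏ m ∈ Finset.univ.image l, ξ m ω)) P := fun k l =>
    ((hM k).integrable_mul (hM l)).const_mul _
  have hexp : ∀ ω, (∑ k ∈ S, c k * ∏ m ∈ Finset.univ.image k, ξ m ω) ^ 2 =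
      ∑ k ∈ S, ∑ l ∈ S, c k * c l * ((∏ m ∈ Finset.univ.image k, ξ m ω) *
        ∏ m ∈ Finset.univ.image l, ξ m ω) := fun ω => by
    rw [sq, Finset.sum_mul_sum]
    exact Finset.sum_congr rfl fun k _ => Finset.sum_congr rfl fun l _ => by ring
  simp_rw [hexp]
  rw [integral_finsetSum _ fun k _ => integrable_finsetSum _ fun l _ => hint k l]
  simp_rw [integral_finsetSum _ fun l _ => hint _ l, integral_const_mul,
    integral_prod_mul_prod hindep hL2 hmean hsq]
  -- Schur test: `c_k c_l ≤ (c_k² + c_l²) / 2`, with each half weighted by `R`. Injectivity is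
  -- demanded of the second argument so that the counting lemma bounds every row sum by `n!`.
  let R : (Fin n → ℕ) → (Fin n → ℕ) → ℝ := fun k l =>
    if Function.Injective l ∧ Finset.univ.image l = Finset.univ.image k then 1 else 0
  have hR : ∀ k, ∑ l ∈ S, R k l ≤ n ! := fun k => by
    simp only [R]
    rw [Finset.sum_boole]
    exact_mod_cast card_filter_image_eq_le S _
  have hle : ∀ k l, c k * c l * (if Finset.univ.image k = Finset.univ.image l then (1 : ℝ) else 0) ≤
      c k ^ 2 / 2 * R k l + c l ^ 2 / 2 * R l k := by
    intro k l
    simp only [R]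
    by_cases hk : Function.Injective k
    · by_cases hl : Function.Injective l
      · by_cases h : Finset.univ.image k = Finset.univ.image l
        · simp only [hk, hl, h, and_self, if_true]
          nlinarith [sq_nonneg (c k - c l)]
        · simp [h, Ne.symm h]
      · simp only [hc l hl, mul_zero, zero_mul]
        positivity
    · simp only [hc k hk, zero_mul]
      positivity
  calc _ ≤ ∑ k ∈ S, ∑ l ∈ S, (c k ^ 2 / 2 * R k l + c l ^ 2 / 2 * R l k) :=
        Finset.sum_le_sum fun k _ => Finset.sum_le_sum fun l _ => hle k l
    _ = ∑ k ∈ S, ∑ l ∈ S, c k ^ 2 / 2 * R k l + ∑ l ∈ S, ∑ k ∈ S, c l ^ 2 / 2 * R l k := by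
        simp_rw [Finset.sum_add_distrib]
        congr 1
        exact Finset.sum_comm
    _ = ∑ k ∈ S, c k ^ 2 * ∑ l ∈ S, R k l := by
        rw [← Finset.sum_add_distrib]
        refine Finset.sum_congr rfl fun k _ => ?_
        rw [← Finset.mul_sum]
        ring
    _ ≤ ∑ k ∈ S, c k ^ 2 * (n ! : ℝ) := by
        gcongr with k
        exact hR k
    _ = _ := by rw [← Finset.sum_mul, mul_comm]

end Chaos

/-! ### Bessel's inequality. -/

section Bessel

/-- Bessel's inequality for a finite orthonormal family of functions. -/
theorem sum_sq_integral_mul_le {α : Type*} [MeasurableSpace α] {μ : Measure α} {ι : Type*}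
    [DecidableEq ι] (S : Finset ι) {F : α → ℝ} {g : ι → α → ℝ} (hF : MemLp F 2 μ)
    (hg : ∀ k, MemLp (g k) 2 μ)
    (hgg : ∀ k l, ∫ x, g k x * g l x ∂μ = if k = l then 1 else 0) :
    ∑ k ∈ S, (∫ x, F x * g k x ∂μ) ^ 2 ≤ ∫ x, F x ^ 2 ∂μ := by
  set c : ι → ℝ := fun k => ∫ x, F x * g k x ∂μ with hc
  -- The squared distance from `F` to its projection is nonnegative; expanding it gives the
  -- inequality.
  have h0 : 0 ≤ ∫ x, (F x - ∑ k ∈ S, c k * g k x) ^ 2 ∂μ := integral_nonneg fun x => sq_nonneg _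
  have hexp : ∀ x, (F x - ∑ k ∈ S, c k * g k x) ^ 2 =
      F x ^ 2 - ∑ k ∈ S, 2 * c k * (F x * g k x) + ∑ k ∈ S, ∑ l ∈ S, c k * c l * (g k x * g l x) := by
    intro x
    have h1 : (∑ k ∈ S, c k * g k x) ^ 2 = ∑ k ∈ S, ∑ l ∈ S, c k * c l * (g k x * g l x) := by
      rw [sq, Finset.sum_mul_sum]
      exact Finset.sum_congr rfl fun k _ => Finset.sum_congr rfl fun l _ => by ring
    rw [← h1, sub_sq, mul_assoc, Finset.mul_sum, Finset.mul_sum]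
    congr 2
    exact Finset.sum_congr rfl fun k _ => by ring
  have hi1 : Integrable (fun x => F x ^ 2) μ := hF.integrable_sq
  have hi2 : ∀ k, Integrable (fun x => 2 * c k * (F x * g k x)) μ := fun k =>
    (hF.integrable_mul (hg k)).const_mul _
  have hi3 : ∀ k l, Integrable (fun x => c k * c l * (g k x * g l x)) μ := fun k l =>
    ((hg k).integrable_mul (hg l)).const_mul _
  have hi12 : Integrable (fun x => F x ^ 2 - ∑ k ∈ S, 2 * c k * (F x * g k x)) μ :=
    hi1.sub (integrable_finsetSum _ fun k _ => hi2 k)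
  simp_rw [hexp] at h0
  rw [integral_add hi12
      (integrable_finsetSum _ fun k _ => integrable_finsetSum _ fun l _ => hi3 k l),
    integral_sub hi1 (integrable_finsetSum _ fun k _ => hi2 k),
    integral_finsetSum _ fun k _ => hi2 k,
    integral_finsetSum _ fun k _ => integrable_finsetSum _ fun l _ => hi3 k l] at h0
  simp_rw [integral_finsetSum _ fun l _ => hi3 _ l, integral_const_mul, hgg] at h0
  have h2 : ∑ k ∈ S, ∑ l ∈ S, c k * c l * (if k = l then (1 : ℝ) else 0) = ∑ k ∈ S, c k ^ 2 := by
    refine Finset.sum_congr rfl fun k hk => ?_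
    simp [hk, sq]
  have h3 : ∑ k ∈ S, 2 * c k * ∫ x, F x * g k x ∂μ = 2 * ∑ k ∈ S, c k ^ 2 := by
    rw [Finset.mul_sum]
    exact Finset.sum_congr rfl fun k _ => by rw [hc]; ring
  rw [h2, h3] at h0
  linarith

end Bessel

/-! ### Expansion of `Y` over blocks, and its second moment. -/

section SecondMoment

/-- The indicator function of the points whose coordinates have mutual distances exceeding `ε`. -/
def separated {n : ℕ} (ε : ℝ) (x : Fin n → ℝ) : ℝ :=
  ∏ p ∈ (Finset.univ : Finset (Fin n)).offDiag, if ε < |x p.1 - x p.2| then (1 : ℝ) else 0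

/-- The normalized indicator function of a product of blocks. -/
def blockProd {n : ℕ} (ε : ℝ) (k : Fin n → ℕ) (x : Fin n → ℝ) : ℝ :=
  ∏ i, (ε⁻¹ * block ε (k i) (x i))

variable {n : ℕ}

theorem measurable_separated (ε : ℝ) : Measurable (separated (n := n) ε) := by
  refine Finset.measurable_fun_prod _ fun p _ => Measurable.ite ?_ measurable_const measurable_const
  exact measurableSet_lt measurable_const (by fun_prop)

theorem norm_separated_le_one (ε : ℝ) (x : Fin n → ℝ) : ‖separated ε x‖ ≤ 1 := by
  rw [separated, norm_prod]
  refine Finset.prod_le_one (fun _ _ => norm_nonneg _) fun p _ => ?_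
  split_ifs <;> simp

theorem measurable_blockProd (ε : ℝ) (k : Fin n → ℕ) : Measurable (blockProd ε k) :=
  Finset.measurable_fun_prod _ fun i _ =>
    ((measurable_block ε (k i)).comp (measurable_pi_apply i)).const_mul _

theorem norm_blockProd_le (ε : ℝ) (k : Fin n → ℕ) (x : Fin n → ℝ) :
    ‖blockProd ε k x‖ ≤ |ε⁻¹| ^ n := by
  rw [blockProd, norm_prod]
  refine (Finset.prod_le_prod (fun _ _ => norm_nonneg _) (g := fun _ => |ε⁻¹|) fun i _ => ?_).trans
    (by simp)
  rw [norm_mul, Real.norm_eq_abs, Real.norm_of_nonneg (block_nonneg _ _ _)]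
  exact mul_le_of_le_one_right (abs_nonneg _) (block_le_one _ _ _)

theorem measurableSet_cube (n : ℕ) (t : ℝ≥0) : MeasurableSet (cube n t) :=
  MeasurableSet.univ_pi fun _ => measurableSet_Icc

theorem cube_mono {s t : ℝ≥0} (h : s ≤ t) : cube n s ⊆ cube n t :=
  Set.pi_mono fun _ _ => Set.Icc_subset_Icc_right (by exact_mod_cast h)

theorem isCompact_cube (n : ℕ) (t : ℝ≥0) : IsCompact (cube n t) :=
  isCompact_univ_pi fun _ => isCompact_Icc

instance isFiniteMeasure_restrict_cube (t : ℝ≥0) :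
    IsFiniteMeasure ((volume : Measure (Fin n → ℝ)).restrict (cube n t)) :=
  ⟨by simpa using (isCompact_cube n t).measure_lt_top⟩

theorem integrable_mul_separated_mul_blockProd {f : (Fin n → ℝ) → ℝ} {μ : Measure (Fin n → ℝ)}
    (hf : Integrable f μ) (ε : ℝ) (k : Fin n → ℕ) :
    Integrable (fun x => f x * separated ε x * blockProd ε k x) μ := by
  have h1 : Integrable (fun x => f x * separated ε x) μ :=
    hf.mul_bdd (c := 1) (measurable_separated ε).aestronglyMeasurable
      (Eventually.of_forall fun x => norm_separated_le_one ε x)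
  exact h1.mul_bdd (c := |ε⁻¹| ^ n) (measurable_blockProd ε k).aestronglyMeasurable
      (Eventually.of_forall fun x => norm_blockProd_le ε k x)

theorem prod_donskerKernel_eq_sum {Ω : Type*} (ξ : ℕ → Ω → ℝ) {ε : ℝ} {t : ℝ≥0} {N : ℕ}
    (hN : t / ε ^ 2 < N) {x : Fin n → ℝ} (hx : x ∈ cube n t) (ω : Ω) :
    ∏ i, donskerKernel ξ ε (x i) ω =
      ∑ k ∈ Fintype.piFinset fun _ : Fin n => Finset.range N,
        (∏ i, ξ (k i) ω) * blockProd ε k x := by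
  have h1 : ∀ i, donskerKernel ξ ε (x i) ω =
      ∑ k ∈ Finset.range N, ξ k ω * (ε⁻¹ * block ε k (x i)) := fun i => by
    refine donskerKernel_eq_sum ξ (lt_of_le_of_lt ?_ hN) ω
    have := (hx i trivial).2
    gcongr
  simp_rw [h1, Finset.prod_univ_sum, blockProd, ← Finset.prod_mul_distrib]

theorem integrable_truncatedIntegrand {Ω : Type*} (ξ : ℕ → Ω → ℝ) (ε : ℝ) {t : ℝ≥0}
    {f : (Fin n → ℝ) → ℝ} (hf : IntegrableOn f (cube n t)) (ω : Ω) :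
    IntegrableOn (fun x => f x * (∏ i, donskerKernel ξ ε (x i) ω) * separated ε x) (cube n t) := by
  obtain ⟨N, hN⟩ := exists_nat_gt (t / ε ^ 2 : ℝ)
  have h1 : IntegrableOn (fun x => ∑ k ∈ Fintype.piFinset fun _ : Fin n => Finset.range N,
      (∏ i, ξ (k i) ω) * (f x * separated ε x * blockProd ε k x)) (cube n t) :=
    integrable_finsetSum _ fun k _ => (integrable_mul_separated_mul_blockProd hf ε k).const_mul _
  refine h1.congr_fun (fun x hx => ?_) (measurableSet_cube n t)
  simp only
  rw [prod_donskerKernel_eq_sum ξ hN hx, Finset.mul_sum, Finset.sum_mul]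
  exact Finset.sum_congr rfl fun k _ => by ring

/-- The chaos expansion: all randomness sits in the monomials, and the coefficients are inner
products with `blockProd`. -/
theorem truncatedIntegral_eq_sum {Ω : Type*} (ξ : ℕ → Ω → ℝ) {ε : ℝ} {t : ℝ≥0} {N : ℕ}
    (hN : t / ε ^ 2 < N) {f : (Fin n → ℝ) → ℝ} (hf : IntegrableOn f (cube n t)) (ω : Ω) :
    truncatedIntegral (donskerKernel ξ ε) ε f t ω =
      ∑ k ∈ Fintype.piFinset fun _ : Fin n => Finset.range N,
        (∫ x in cube n t, f x * separated ε x * blockProd ε k x) * ∏ i, ξ (k i) ω := by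
  calc _ = ∫ x in cube n t, ∑ k ∈ Fintype.piFinset fun _ : Fin n => Finset.range N,
      (f x * separated ε x * blockProd ε k x) * ∏ i, ξ (k i) ω := by
        refine setIntegral_congr_fun (measurableSet_cube n t) fun x hx => ?_
        rw [prod_donskerKernel_eq_sum ξ hN hx, Finset.mul_sum, Finset.sum_mul]
        exact Finset.sum_congr rfl fun k _ => by unfold separated; ring
    _ = _ := by
        rw [integral_finsetSum _ fun k _ =>
          (integrable_mul_separated_mul_blockProd hf ε k).mul_const _]
        simp_rw [integral_mul_const]

theorem aemeasurable_truncatedIntegral {Ω : Type*} [MeasurableSpace Ω] {P : Measure Ω}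
    {ξ : ℕ → Ω → ℝ} (hξ : ∀ k, AEMeasurable (ξ k) P) (ε : ℝ) {t : ℝ≥0}
    {f : (Fin n → ℝ) → ℝ} (hf : IntegrableOn f (cube n t)) :
    AEMeasurable (truncatedIntegral (donskerKernel ξ ε) ε f t) P := by
  obtain ⟨N, hN⟩ := exists_nat_gt (t / ε ^ 2 : ℝ)
  rw [show truncatedIntegral (donskerKernel ξ ε) ε f t = _ from
    funext fun ω => truncatedIntegral_eq_sum ξ hN hf ω]
  exact Finset.aemeasurable_fun_sum _ fun k _ =>
    (Finset.aemeasurable_fun_prod _ fun i _ => hξ (k i)).const_mul _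

/-- Two coordinates in one block are closer than `ε²`, and `ε² ≤ ε` because `ε ≤ 1`. -/
theorem separated_mul_blockProd_eq_zero {ε : ℝ} (hε : 0 < ε) (hε1 : ε ≤ 1) {k : Fin n → ℕ}
    (hk : ¬ Function.Injective k) (x : Fin n → ℝ) : separated ε x * blockProd ε k x = 0 := by
  obtain ⟨i, j, hkij, hij⟩ : ∃ i j, k i = k j ∧ i ≠ j := by
    simpa [Function.Injective] using hk
  rcases block_eq_zero_or_one ε (k i) (x i) with hi | hi
  · rw [blockProd, Finset.prod_eq_zero (Finset.mem_univ i) (by rw [hi, mul_zero]), mul_zero]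
  rcases block_eq_zero_or_one ε (k j) (x j) with hj | hj
  · rw [blockProd, Finset.prod_eq_zero (Finset.mem_univ j) (by rw [hj, mul_zero]), mul_zero]
  rw [separated, Finset.prod_eq_zero (i := (i, j)) (by simpa using hij), zero_mul]
  rw [block_eq_one_iff] at hi hj
  rw [hkij] at hi
  have hε2 : (0 : ℝ) < ε ^ 2 := by positivity
  simp only [le_div_iff₀ hε2, div_lt_iff₀ hε2] at hi hj
  have h2 : ε ^ 2 ≤ ε := by nlinarith
  rw [if_neg]
  rw [not_lt, abs_le]
  constructor <;> nlinarith [hi.1, hi.2, hj.1, hj.2]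

theorem integral_univ_block {ε : ℝ} (hε : 0 < ε) (k : ℕ) : ∫ x, block ε k x = ε ^ 2 := by
  have : (k : ℝ) * ε ^ 2 ≤ (k + 1) * ε ^ 2 := by nlinarith [sq_nonneg ε]
  rw [block_eq_indicator hε, integral_indicator measurableSet_Ico]
  simp only [integral_const, smul_eq_mul, mul_one, measureReal_restrict_apply_univ,
    Real.volume_real_Ico_of_le this]
  ring

theorem integrable_block {ε : ℝ} (hε : 0 < ε) (k : ℕ) : Integrable (block ε k) := by
  rw [block_eq_indicator hε, integrable_indicator_iff measurableSet_Ico]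
  exact integrableOn_const (by simp)

theorem block_mul_self (ε : ℝ) (k : ℕ) (s : ℝ) : block ε k s * block ε k s = block ε k s := by
  rcases block_eq_zero_or_one ε k s with h | h <;> simp [h]

theorem memLp_blockProd {ε : ℝ} (hε : 0 < ε) (k : Fin n → ℕ) :
    MemLp (blockProd ε k) 2 volume := by
  rw [memLp_two_iff_integrable_sq (measurable_blockProd ε k).aestronglyMeasurable]
  have h : Integrable (fun x : Fin n → ℝ => ∏ i, (ε⁻¹ ^ 2 * block ε (k i) (x i))) :=
    Integrable.fintype_prod (f := fun i y => ε⁻¹ ^ 2 * block ε (k i) y)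
      fun i => (integrable_block hε (k i)).const_mul _
  refine h.congr (Eventually.of_forall fun x => ?_)
  simp only [blockProd, ← Finset.prod_pow]
  exact Finset.prod_congr rfl fun i _ => by rw [mul_pow, sq (block _ _ _), block_mul_self]

/-- Distinct blocks are disjoint, and the factor `ε⁻¹` normalizes a block of length `ε²` in `L²`. -/
theorem integral_blockProd_mul_blockProd {ε : ℝ} (hε : 0 < ε) (k l : Fin n → ℕ) :
    ∫ x, blockProd ε k x * blockProd ε l x = if k = l then 1 else 0 := by
  have h1 : ∀ x, blockProd ε k x * blockProd ε l x =
      ∏ i, (ε⁻¹ ^ 2 * (block ε (k i) (x i) * block ε (l i) (x i))) := fun x => by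
    rw [blockProd, blockProd, ← Finset.prod_mul_distrib]
    exact Finset.prod_congr rfl fun i _ => by ring
  simp_rw [h1]
  rw [integral_fintype_prod_volume_eq_prod
    fun i y => ε⁻¹ ^ 2 * (block ε (k i) y * block ε (l i) y)]
  split_ifs with h
  · subst h
    refine Finset.prod_eq_one fun i _ => ?_
    simp_rw [block_mul_self]
    rw [integral_const_mul, integral_univ_block hε]
    field_simp
  · obtain ⟨i, hi⟩ := Function.ne_iff.1 h
    refine Finset.prod_eq_zero (Finset.mem_univ i) ?_
    simp [block_mul_block_of_ne ε hi]

/-- The second moments of the approximating multiple integrals. -/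
theorem memLp_and_integral_sq_truncatedIntegral_le {Ω : Type*} [MeasurableSpace Ω] {P : Measure Ω}
    {ξ : ℕ → Ω → ℝ} (hindep : iIndepFun ξ P) (hL2 : ∀ k, MemLp (ξ k) 2 P)
    (hmean : ∀ k, ∫ ω, ξ k ω ∂P = 0) (hsq : ∀ k, ∫ ω, ξ k ω ^ 2 ∂P = 1)
    {T : ℝ≥0} {f : (Fin n → ℝ) → ℝ} (hf : MemLp f 2 (volume.restrict (cube n T)))
    {ε : ℝ} (hε : 0 < ε) (hε1 : ε ≤ 1) {t : ℝ≥0} (ht : t ≤ T) :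
    MemLp (truncatedIntegral (donskerKernel ξ ε) ε f t) 2 P ∧
      ∫ ω, (truncatedIntegral (donskerKernel ξ ε) ε f t ω) ^ 2 ∂P ≤
        (n ! : ℝ) * ∫ x in cube n T, (f x) ^ 2 := by
  obtain ⟨N, hN⟩ := exists_nat_gt (t / ε ^ 2 : ℝ)
  have hft : MemLp f 2 (volume.restrict (cube n t)) :=
    hf.mono_measure (Measure.restrict_mono (cube_mono ht) le_rfl)
  have hfi : IntegrableOn f (cube n t) := hft.integrable one_le_two
  set c : (Fin n → ℕ) → ℝ := fun k => ∫ x in cube n t, f x * separated ε x * blockProd ε k x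
    with hc
  have hY : truncatedIntegral (donskerKernel ξ ε) ε f t = fun ω =>
      ∑ k ∈ Fintype.piFinset fun _ : Fin n => Finset.range N, c k * ∏ i, ξ (k i) ω :=
    funext fun ω => truncatedIntegral_eq_sum ξ hN hfi ω
  have hc0 : ∀ k, ¬ Function.Injective k → c k = 0 := fun k hk => by
    simp only [hc, mul_assoc, separated_mul_blockProd_eq_zero hε hε1 hk, mul_zero, integral_zero]
  obtain ⟨h1, h2⟩ := memLp_and_integral_sq_sum_le hindep hL2 hmean hsq
    (Fintype.piFinset fun _ : Fin n => Finset.range N) c hc0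
  rw [hY]
  refine ⟨h1, h2.trans (mul_le_mul_of_nonneg_left ?_ (Nat.cast_nonneg _))⟩
  -- Extension by zero to the whole space: blocks may stick out of the cube, and the block products
  -- are orthonormal only on all of `ℝⁿ`.
  set F : (Fin n → ℝ) → ℝ := (cube n t).indicator fun x => f x * separated ε x with hF
  have hFL : MemLp F 2 volume := by
    rw [hF, memLp_indicator_iff_restrict (measurableSet_cube n t)]
    refine hft.mono (hft.1.mul (measurable_separated ε).aestronglyMeasurable)
      (Eventually.of_forall fun x => ?_)
    rw [norm_mul]
    exact mul_le_of_le_one_right (norm_nonneg _) (norm_separated_le_one _ _)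
  have hcF : ∀ k, c k = ∫ x, F x * blockProd ε k x := fun k => by
    rw [hc]
    simp only
    rw [← integral_indicator (measurableSet_cube n t)]
    congr 1
    ext x
    by_cases hx : x ∈ cube n t <;> simp [hF, hx]
  simp_rw [hcF]
  refine (sum_sq_integral_mul_le _ hFL (fun k => memLp_blockProd hε k)
    (integral_blockProd_mul_blockProd hε)).trans ?_
  rw [← integral_indicator (measurableSet_cube n T)]
  refine integral_mono hFL.integrable_sq
    ((integrable_indicator_iff (measurableSet_cube n T)).2 hf.integrable_sq) fun x => ?_
  by_cases hx : x ∈ cube n t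
  · simp only [hF, hx, cube_mono ht hx, Set.indicator_of_mem]
    rw [mul_pow]
    refine mul_le_of_le_one_right (sq_nonneg _) ?_
    rw [sq_le_one_iff_abs_le_one]
    exact norm_separated_le_one ε x
  · simp only [hF, hx, Set.indicator_of_notMem, not_false_eq_true]
    rw [zero_pow two_ne_zero]
    exact Set.indicator_nonneg (fun _ _ => sq_nonneg _) _

end SecondMoment

/-! ### Off-diagonal simple functions: convergence and moment bound. -/

section SimpleFunctions

/-- Independent, identically distributed random variables with mean `0` and variance `1`. -/
structure IsStandardIID {Ω : Type*} [MeasurableSpace Ω] (ξ : ℕ → Ω → ℝ) (P : Measure Ω) : Prop where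
  indep : iIndepFun ξ P
  ident : ∀ k, IdentDistrib (ξ k) (ξ 0) P P
  memLp : ∀ k, MemLp (ξ k) 2 P
  mean : ∀ k, ∫ ω, ξ k ω ∂P = 0
  sq : ∀ k, ∫ ω, ξ k ω ^ 2 ∂P = 1

theorem IsStandardIID.aemeasurable {Ω : Type*} [MeasurableSpace Ω] {ξ : ℕ → Ω → ℝ} {P : Measure Ω}
    (h : IsStandardIID ξ P) (k : ℕ) : AEMeasurable (ξ k) P :=
  (h.ident k).aemeasurable_fst

theorem isStandardIID {Ω : Type*} [MeasurableSpace Ω] {P : Measure Ω} [IsProbabilityMeasure P]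
    {ξ : ℕ → Ω → ℝ} (hindep : iIndepFun ξ P) (hident : ∀ k, IdentDistrib (ξ k) (ξ 0) P P)
    (hL2 : MemLp (ξ 0) 2 P) (hmean : ∫ ω, ξ 0 ω ∂P = 0) (hvar : variance (ξ 0) P = 1) :
    IsStandardIID ξ P where
  indep := hindep
  ident := hident
  memLp k := (hident k).memLp_iff.2 hL2
  mean k := by rw [(hident k).integral_eq, hmean]
  sq k := by
    have h1 : ∫ ω, ξ k ω ^ 2 ∂P = ∫ ω, ξ 0 ω ^ 2 ∂P :=
      ((hident k).comp (measurable_id.pow_const 2)).integral_eq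
    rw [h1, ← hvar, variance_of_integral_eq_zero hL2.aestronglyMeasurable.aemeasurable hmean]

/-- The right side is a lower integral, so the identity applies before square integrability is
known. -/
theorem eLpNorm_two_sq {α : Type*} [MeasurableSpace α] (μ : Measure α) (f : α → ℝ) :
    eLpNorm f 2 μ ^ 2 = ∫⁻ x, ENNReal.ofReal (f x ^ 2) ∂μ := by
  have h := eLpNorm_nnreal_pow_eq_lintegral (μ := μ) (f := f) (p := 2) two_ne_zero
  norm_num at h
  rw [h]
  congr with x
  rw [← Real.enorm_of_nonneg (sq_nonneg (f x)), enorm_pow]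

theorem eLpNorm_two_sq_eq_ofReal {α : Type*} [MeasurableSpace α] {μ : Measure α} {f : α → ℝ}
    (hf : MemLp f 2 μ) : eLpNorm f 2 μ ^ 2 = ENNReal.ofReal (∫ x, f x ^ 2 ∂μ) := by
  rw [eLpNorm_two_sq, ofReal_integral_eq_lintegral_ofReal hf.integrable_sq
    (Eventually.of_forall fun x => sq_nonneg _)]

theorem eLpNorm_truncatedIntegral_le {Ω : Type*} [MeasurableSpace Ω] {P : Measure Ω}
    {ξ : ℕ → Ω → ℝ} (hξ : IsStandardIID ξ P) {n : ℕ} {T : ℝ≥0} {f : (Fin n → ℝ) → ℝ}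
    (hf : MemLp f 2 (volume.restrict (cube n T))) {ε : ℝ} (hε : 0 < ε) (hε1 : ε ≤ 1) :
    eLpNorm (truncatedIntegral (donskerKernel ξ ε) ε f T) 2 P ^ 2 ≤
      (n ! : ℝ≥0∞) * eLpNorm f 2 (volume.restrict (cube n T)) ^ 2 := by
  obtain ⟨h1, h2⟩ := memLp_and_integral_sq_truncatedIntegral_le hξ.indep hξ.memLp hξ.mean hξ.sq
    hf hε hε1 le_rfl
  rw [eLpNorm_two_sq_eq_ofReal h1, eLpNorm_two_sq_eq_ofReal hf, ← ENNReal.ofReal_natCast,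
    ← ENNReal.ofReal_mul (Nat.cast_nonneg _)]
  exact ENNReal.ofReal_le_ofReal h2

variable {n : ℕ} {T : ℝ≥0}

theorem OffDiagBox.measurableSet_toSet (B : OffDiagBox n T) : MeasurableSet B.toSet :=
  MeasurableSet.univ_pi fun _ => measurableSet_Ioc

theorem OffDiagBox.toSet_subset_cube (B : OffDiagBox n T) : B.toSet ⊆ cube n T :=
  Set.pi_mono fun i _ x hx =>
    ⟨(B.lo i).2.trans hx.1.le, hx.2.trans (by exact_mod_cast B.hi_le i)⟩

/-- Disjoint closed sides are ordered with a strictly positive gap, and there are finitely many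
pairs of sides. -/
theorem OffDiagBox.eventually_separated (B : OffDiagBox n T) :
    ∀ᶠ ε : ℝ in 𝓝[>] 0, ∀ x ∈ B.toSet, separated ε x = 1 := by
  have h : ∀ p : Fin n × Fin n, p.1 ≠ p.2 →
      ∀ᶠ ε : ℝ in 𝓝[>] 0, ∀ x ∈ B.toSet, ε < |x p.1 - x p.2| := by
    rintro ⟨i, j⟩ hij
    simp only at hij ⊢
    wlog hlt : B.hi i < B.lo j generalizing i j
    · have hlt' : B.hi j < B.lo i := by
        by_contra hcon
        -- If neither side lay strictly to the left of the other, the larger lower endpoint would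
        -- belong to both.
        have h1 : max (B.lo i) (B.lo j) ∈ Set.Icc (B.lo i) (B.hi i) :=
          ⟨le_max_left _ _, max_le (B.lo_le_hi i) (not_lt.1 hlt)⟩
        exact Set.disjoint_left.1 (B.disjoint i j hij) h1
          ⟨le_max_right _ _, max_le (not_lt.1 hcon) (B.lo_le_hi j)⟩
      simpa only [abs_sub_comm] using this j i hij.symm hlt'
    have hpos : (0 : ℝ) < B.lo j - B.hi i := sub_pos.2 (by exact_mod_cast hlt)
    filter_upwards [nhdsWithin_le_nhds (gt_mem_nhds hpos)] with ε hε x hx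
    rw [abs_sub_comm]
    refine lt_of_lt_of_le hε ((?_ : _ ≤ x j - x i).trans (le_abs_self _))
    linarith [(hx j trivial).1, (hx i trivial).2]
  have h' : ∀ᶠ ε : ℝ in 𝓝[>] 0, ∀ p : Fin n × Fin n, p.1 ≠ p.2 →
      ∀ x ∈ B.toSet, ε < |x p.1 - x p.2| := by
    rw [eventually_all]
    intro p
    by_cases hp : p.1 = p.2
    · simp [hp]
    · filter_upwards [h p hp] with ε hε _ using hε
  filter_upwards [h'] with ε hε x hx
  refine Finset.prod_eq_one fun p hp => ?_
  rw [Finset.mem_offDiag] at hp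
  rw [if_pos (hε p hp.2.2 x hx)]

theorem measurable_indicator_one (B : OffDiagBox n T) :
    Measurable (B.toSet.indicator fun _ => (1 : ℝ)) :=
  measurable_const.indicator B.measurableSet_toSet

theorem OffDiagSimple.measurable_eval (g : OffDiagSimple n T) : Measurable g.eval :=
  Finset.measurable_fun_sum _ fun k _ => (measurable_indicator_one (g.box k)).const_mul _

theorem memLp_indicator_one {μ : Measure (Fin n → ℝ)} [IsFiniteMeasure μ] (B : OffDiagBox n T)
    (p : ℝ≥0∞) : MemLp (B.toSet.indicator fun _ => (1 : ℝ)) p μ :=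
  (memLp_const 1).indicator B.measurableSet_toSet

theorem OffDiagSimple.memLp_eval {μ : Measure (Fin n → ℝ)} [IsFiniteMeasure μ]
    (g : OffDiagSimple n T) (p : ℝ≥0∞) : MemLp g.eval p μ :=
  memLp_finsetSum _ fun k _ => (memLp_indicator_one (g.box k) p).const_mul _

theorem setIntegral_box_prod (B : OffDiagBox n T) {θ : ℝ → ℝ}
    (hθ : ∀ a b, IntervalIntegrable θ volume a b) :
    ∫ x in B.toSet, ∏ i, θ (x i) =
      ∏ i, ((∫ x in (0 : ℝ)..B.hi i, θ x) - ∫ x in (0 : ℝ)..B.lo i, θ x) := by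
  rw [OffDiagBox.toSet, volume_pi, Measure.restrict_pi_pi,
    integral_fintype_prod_eq_prod fun _ => θ]
  refine Finset.prod_congr rfl fun i _ => ?_
  rw [intervalIntegral.integral_interval_sub_left (hθ _ _) (hθ _ _),
    intervalIntegral.integral_of_le (by exact_mod_cast B.lo_le_hi i)]

/-- For small `ε` the truncation does not affect off-diagonal simple functions. -/
theorem OffDiagSimple.eventually_truncatedIntegral_eq {Ω : Type*} (ξ : ℕ → Ω → ℝ)
    (g : OffDiagSimple n T) :
    ∀ᶠ ε : ℝ in 𝓝[>] 0, ∀ ω, truncatedIntegral (donskerKernel ξ ε) ε g.eval T ω =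
      g.integral (donskerWalk ξ ε) ω := by
  filter_upwards [eventually_all.2 fun k => (g.box k).eventually_separated] with ε hε ω
  have hint : ∀ k, IntegrableOn (fun x => (g.box k).toSet.indicator (fun _ => (1 : ℝ)) x *
      (∏ i, donskerKernel ξ ε (x i) ω) * separated ε x) (cube n T) := fun k =>
    integrable_truncatedIntegrand ξ ε
      ((memLp_indicator_one (g.box k) 1).integrable le_rfl) ω
  calc truncatedIntegral (donskerKernel ξ ε) ε g.eval T ω
      = ∫ x in cube n T, ∑ k, g.coeff k * ((g.box k).toSet.indicator (fun _ => (1 : ℝ)) x *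
        (∏ i, donskerKernel ξ ε (x i) ω) * separated ε x) := by
        refine integral_congr_ae (Eventually.of_forall fun x => ?_)
        simp only [OffDiagSimple.eval]
        rw [Finset.sum_mul, Finset.sum_mul]
        exact Finset.sum_congr rfl fun k _ => by unfold separated; ring
    _ = ∑ k, g.coeff k * ∫ x in cube n T, (g.box k).toSet.indicator (fun _ => (1 : ℝ)) x *
        (∏ i, donskerKernel ξ ε (x i) ω) * separated ε x := by
        rw [integral_finsetSum _ fun k _ => (hint k).const_mul _]
        simp_rw [integral_const_mul]
    _ = _ := by
        refine Finset.sum_congr rfl fun k _ => ?_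
        congr 1
        have h1 : ∀ x, (g.box k).toSet.indicator (fun _ => (1 : ℝ)) x *
            (∏ i, donskerKernel ξ ε (x i) ω) * separated ε x =
            (g.box k).toSet.indicator (fun x => ∏ i, donskerKernel ξ ε (x i) ω) x := fun x => by
          by_cases hx : x ∈ (g.box k).toSet
          · simp [hx, hε k x hx]
          · simp [hx]
        simp_rw [h1]
        rw [setIntegral_indicator (g.box k).measurableSet_toSet,
          Set.inter_eq_right.2 (g.box k).toSet_subset_cube,
          setIntegral_box_prod _ fun a b => intervalIntegrable_donskerKernel ξ ε a b ω]
        rfl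

theorem OffDiagSimple.aemeasurable_integral {Ω' : Type*} [MeasurableSpace Ω'] {P' : Measure Ω'}
    {W : ℝ≥0 → Ω' → ℝ} (hW : IsPreBrownianReal W P')
    (g : OffDiagSimple n T) : AEMeasurable (g.integral W) P' :=
  Finset.aemeasurable_fun_sum _ fun _ _ => (Finset.aemeasurable_fun_prod _ fun _ _ =>
    (hW.aemeasurable _).sub (hW.aemeasurable _)).const_mul _

variable {Ω : Type*} [MeasurableSpace Ω] {P : Measure Ω} [IsProbabilityMeasure P]
  {Ω' : Type*} [MeasurableSpace Ω'] {P' : Measure Ω'} [IsProbabilityMeasure P']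
  {ξ : ℕ → Ω → ℝ} {W : ℝ≥0 → Ω' → ℝ}

/-- The integrals are polynomials in finitely many values of the walk, so Donsker's theorem and
continuous mapping apply. -/
theorem tendstoInDistribution_integral_simple (hξ : IsStandardIID ξ P)
    (hW : IsPreBrownianReal W P') {r : ℕ} (g : Fin r → OffDiagSimple n T) :
    TendstoInDistribution (fun (ε : ℝ) ω j => (g j).integral (donskerWalk ξ ε) ω) (𝓝[>] 0)
      (fun ω j => (g j).integral W ω) (fun _ => P) P' := by
  -- One index per function, box, side and endpoint; `true` marks the upper endpoint.
  let ι := (j : Fin r) × Fin (g j).m × Fin n × Bool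
  let s : ι → ℝ≥0 := fun q =>
    if q.2.2.2 then ((g q.1).box q.2.1).hi q.2.2.1 else ((g q.1).box q.2.1).lo q.2.2.1
  have h := tendstoInDistribution_donskerWalk hξ.indep hξ.ident (hξ.mean 0) (hξ.sq 0) hW s
  exact h.continuous_comp (g := fun (v : ι → ℝ) j => ∑ k, (g j).coeff k *
    ∏ i, (v ⟨j, k, i, true⟩ - v ⟨j, k, i, false⟩)) (by fun_prop)

/-- Fatou's lemma for weak convergence, from the portmanteau inequality on open sets, along a
sequence tending to `0`. -/
theorem lintegral_sq_le_of_tendstoInDistribution {X : ℝ → Ω → Fin 1 → ℝ} {Z : Ω' → Fin 1 → ℝ}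
    (h : TendstoInDistribution X (𝓝[>] 0) Z (fun _ => P) P') {C : ℝ≥0∞}
    (hC : ∀ᶠ ε in 𝓝[>] 0, ∫⁻ ω, ENNReal.ofReal (X ε ω 0 ^ 2) ∂P ≤ C) :
    ∫⁻ ω, ENNReal.ofReal (Z ω 0 ^ 2) ∂P' ≤ C := by
  obtain ⟨u, hu⟩ := exists_seq_tendsto (𝓝[>] (0 : ℝ))
  have hlim := h.tendsto.comp hu
  have hcont : Continuous fun x : Fin 1 → ℝ => x 0 ^ 2 := by fun_prop
  have hfatou := lintegral_le_liminf_lintegral_of_forall_isOpen_measure_le_liminf_measure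
    (μ := P'.map Z) (μs := fun k => P.map (X (u k))) hcont (fun x => sq_nonneg _)
    fun G hG => ProbabilityMeasure.le_liminf_measure_open_of_tendsto hlim hG
  rw [lintegral_map' hcont.measurable.ennreal_ofReal.aemeasurable h.aemeasurable_limit] at hfatou
  refine hfatou.trans (liminf_le_of_frequently_le' ?_)
  refine ((hu.eventually hC).mono fun k hk => ?_).frequently
  rwa [lintegral_map' hcont.measurable.ennreal_ofReal.aemeasurable (h.forall_aemeasurable _)]

/-- The second moment of the multiple Wiener–Itô integral of a simple function, obtained by passing
to the limit in the corresponding bound for the approximating integrals. -/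
theorem OffDiagSimple.eLpNorm_integral_le (hξ : IsStandardIID ξ P)
    (hW : IsPreBrownianReal W P') (g : OffDiagSimple n T) :
    eLpNorm (g.integral W) 2 P' ^ 2 ≤
      (n ! : ℝ≥0∞) * eLpNorm g.eval 2 (volume.restrict (cube n T)) ^ 2 := by
  rw [eLpNorm_two_sq]
  refine lintegral_sq_le_of_tendstoInDistribution
    (tendstoInDistribution_integral_simple hξ hW fun _ : Fin 1 => g) ?_
  filter_upwards [g.eventually_truncatedIntegral_eq ξ, self_mem_nhdsWithin,
    nhdsWithin_le_nhds (ge_mem_nhds (zero_lt_one' ℝ))] with ε hε hε0 hε1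
  simp_rw [← hε]
  rw [← eLpNorm_two_sq]
  exact eLpNorm_truncatedIntegral_le hξ (g.memLp_eval 2) hε0 hε1

end SimpleFunctions

/-! ### Density of off-diagonal simple functions in `L²`. -/

section Density

variable {n : ℕ} {T : ℝ≥0}

/-- The simple function with coefficients and boxes indexed by a finite type. -/
def OffDiagSimple.ofFintype {ι : Type*} [Fintype ι] (a : ι → ℝ) (B : ι → OffDiagBox n T) :
    OffDiagSimple n T where
  m := Fintype.card ι
  coeff k := a ((Fintype.equivFin ι).symm k)
  box k := B ((Fintype.equivFin ι).symm k)

theorem OffDiagSimple.eval_ofFintype {ι : Type*} [Fintype ι] (a : ι → ℝ)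
    (B : ι → OffDiagBox n T) (x : Fin n → ℝ) :
    (OffDiagSimple.ofFintype a B).eval x =
      ∑ k, a k * (B k).toSet.indicator (fun _ => (1 : ℝ)) x :=
  (Fintype.equivFin ι).symm.sum_comp fun k => a k * (B k).toSet.indicator (fun _ => (1 : ℝ)) x

theorem OffDiagSimple.integral_ofFintype {Ω : Type*} {ι : Type*} [Fintype ι] (a : ι → ℝ)
    (B : ι → OffDiagBox n T) (W : ℝ≥0 → Ω → ℝ) (ω : Ω) :
    (OffDiagSimple.ofFintype a B).integral W ω =
      ∑ k, a k * ∏ i, (W ((B k).hi i) ω - W ((B k).lo i) ω) :=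
  (Fintype.equivFin ι).symm.sum_comp fun k =>
    a k * ∏ i, (W ((B k).hi i) ω - W ((B k).lo i) ω)

/-- The difference of two simple functions. -/
def OffDiagSimple.sub (g h : OffDiagSimple n T) : OffDiagSimple n T :=
  OffDiagSimple.ofFintype (ι := Fin g.m ⊕ Fin h.m) (Sum.elim g.coeff fun k => -h.coeff k)
    (Sum.elim g.box h.box)

theorem OffDiagSimple.eval_sub (g h : OffDiagSimple n T) (x : Fin n → ℝ) :
    (g.sub h).eval x = g.eval x - h.eval x := by
  rw [OffDiagSimple.sub, OffDiagSimple.eval_ofFintype, Fintype.sum_sum_type]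
  simp [OffDiagSimple.eval, sub_eq_add_neg]

theorem OffDiagSimple.integral_sub {Ω : Type*} (g h : OffDiagSimple n T) (W : ℝ≥0 → Ω → ℝ)
    (ω : Ω) : (g.sub h).integral W ω = g.integral W ω - h.integral W ω := by
  rw [OffDiagSimple.sub, OffDiagSimple.integral_ofFintype, Fintype.sum_sum_type]
  simp [OffDiagSimple.integral, sub_eq_add_neg]

/-- The multi-indices whose entries have mutual distances at least two. -/
abbrev GridIndex (n N : ℕ) : Type :=
  {k : Fin n → Fin N // ∀ i j, i ≠ j → (k i : ℕ) + 1 < k j ∨ (k j : ℕ) + 1 < k i}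

/-- The box `∏ (k_i T/N, (k_i + 1) T/N]`. -/
def gridBox (hT : Fin n → 0 < T) {N : ℕ} (k : GridIndex n N) : OffDiagBox n T where
  lo i := (k.1 i : ℕ) * (T / N)
  hi i := ((k.1 i : ℕ) + 1) * (T / N)
  lo_le_hi i := by gcongr; simp
  hi_le i := by
    have hN : (0 : ℝ≥0) < N := by exact_mod_cast (k.1 i).pos
    have h : ((k.1 i : ℕ) : ℝ≥0) + 1 ≤ N := by exact_mod_cast (k.1 i).2
    calc _ ≤ (N : ℝ≥0) * (T / N) := by gcongr
      _ = T := mul_div_cancel₀ _ hN.ne'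
  -- Neighbouring cells share an endpoint, so their closures meet; hence the gap of two between
  -- indices.
  disjoint i j hij := by
    have hN : (0 : ℝ≥0) < N := by exact_mod_cast (k.1 i).pos
    have hTN : 0 < T / N := div_pos (hT i) hN
    rw [Set.disjoint_left]
    rintro x ⟨h1, h2⟩ ⟨h3, h4⟩
    rcases k.2 i j hij with h | h
    · have h' : ((k.1 i : ℕ) : ℝ≥0) + 1 < (k.1 j : ℕ) := by exact_mod_cast h
      exact absurd (h3.trans h2) (not_le.2 (by gcongr))
    · have h' : ((k.1 j : ℕ) : ℝ≥0) + 1 < (k.1 i : ℕ) := by exact_mod_cast h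
      exact absurd (h1.trans h4) (not_le.2 (by gcongr))

/-- The lower corner of a box. -/
def OffDiagBox.corner (B : OffDiagBox n T) : Fin n → ℝ := fun i => B.lo i

/-- The grid approximation of a function. -/
def gridApprox (hT : Fin n → 0 < T) (N : ℕ) (h : (Fin n → ℝ) → ℝ) : OffDiagSimple n T :=
  OffDiagSimple.ofFintype (ι := GridIndex n N) (fun k => h (gridBox hT k).corner) (gridBox hT)

theorem gridBox_unique (hT : Fin n → 0 < T) {N : ℕ} {k l : GridIndex n N} {x : Fin n → ℝ}
    (hk : x ∈ (gridBox hT k).toSet) (hl : x ∈ (gridBox hT l).toSet) : k = l := by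
  ext i
  have hN : (0 : ℝ) < N := by exact_mod_cast (k.1 i).pos
  have hTN : (0 : ℝ) < T / N := div_pos (by exact_mod_cast hT i) hN
  have h1 := hk i trivial
  have h2 := hl i trivial
  simp only [gridBox, Set.mem_Ioc, NNReal.coe_mul, NNReal.coe_add, NNReal.coe_div,
    NNReal.coe_natCast, NNReal.coe_one] at h1 h2
  have h3 : ((k.1 i : ℕ) : ℝ) < (l.1 i : ℕ) + 1 :=
    lt_of_mul_lt_mul_right (h1.1.trans_le h2.2) hTN.le
  have h4 : ((l.1 i : ℕ) : ℝ) < (k.1 i : ℕ) + 1 :=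
    lt_of_mul_lt_mul_right (h2.1.trans_le h1.2) hTN.le
  norm_cast at h3 h4
  omega

theorem eval_gridApprox_of_mem (hT : Fin n → 0 < T) {N : ℕ} (h : (Fin n → ℝ) → ℝ)
    {k : GridIndex n N} {x : Fin n → ℝ} (hk : x ∈ (gridBox hT k).toSet) :
    (gridApprox hT N h).eval x = h (gridBox hT k).corner := by
  rw [gridApprox, OffDiagSimple.eval_ofFintype, Finset.sum_eq_single k]
  · simp [hk]
  · intro l _ hlk
    rw [Set.indicator_of_notMem fun hl => hlk (gridBox_unique hT hl hk), mul_zero]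
  · simp

theorem abs_eval_gridApprox_le (hT : Fin n → 0 < T) (N : ℕ) {h : (Fin n → ℝ) → ℝ} {M : ℝ}
    (hM : ∀ x, |h x| ≤ M) (x : Fin n → ℝ) : |(gridApprox hT N h).eval x| ≤ M := by
  by_cases hx : ∃ k : GridIndex n N, x ∈ (gridBox hT k).toSet
  · obtain ⟨k, hk⟩ := hx
    rw [eval_gridApprox_of_mem hT h hk]
    exact hM _
  · push Not at hx
    rw [gridApprox, OffDiagSimple.eval_ofFintype, Finset.sum_eq_zero fun k _ => by
      rw [Set.indicator_of_notMem (hx k), mul_zero], abs_zero]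
    exact (abs_nonneg _).trans (hM 0)

/-- Coordinates more than two mesh widths apart cannot lie in equal or adjacent cells. -/
theorem exists_mem_gridBox (hT : Fin n → 0 < T) {N : ℕ} {x : Fin n → ℝ}
    (hx : ∀ i, x i ∈ Set.Ioc (0 : ℝ) T)
    (hN : ∀ i j, i ≠ j → 2 * (T : ℝ) < |x i - x j| * N) (hN0 : 0 < N) :
    ∃ k : GridIndex n N, x ∈ (gridBox hT k).toSet := by
  have hN0' : (0 : ℝ) < N := by exact_mod_cast hN0
  have key : ∀ i, ∃ m : Fin N, (m : ℕ) * ((T : ℝ) / N) < x i ∧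
      x i ≤ ((m : ℕ) + 1) * ((T : ℝ) / N) := by
    intro i
    have hT0 : (0 : ℝ) < T := by exact_mod_cast hT i
    have hTN : (0 : ℝ) < T / N := div_pos hT0 hN0'
    have hpos : 0 < x i / (T / N) := div_pos (hx i).1 hTN
    have hle : x i / (T / N) ≤ N := by
      rw [div_le_iff₀ hTN, mul_div_cancel₀ _ hN0'.ne']
      exact (hx i).2
    have hc : ⌈x i / (T / N)⌉₊ ≤ N := Nat.ceil_le.2 hle
    have hc0 : 0 < ⌈x i / (T / N)⌉₊ := Nat.ceil_pos.2 hpos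
    -- Cells are open on the left, so the cell index is the ceiling minus one.
    obtain ⟨m, hm⟩ := Nat.exists_eq_succ_of_ne_zero hc0.ne'
    refine ⟨⟨m, by omega⟩, ?_, ?_⟩
    · rw [← lt_div_iff₀ hTN]
      exact Nat.lt_ceil.1 (show m < _ by omega)
    · rw [← div_le_iff₀ hTN]
      have := Nat.le_ceil (x i / (T / N))
      rw [hm] at this
      exact_mod_cast this
  choose k hk1 hk2 using key
  refine ⟨⟨k, fun i j hij => ?_⟩, fun i _ => ?_⟩
  · by_contra hcon
    push Not at hcon
    have hT0 : (0 : ℝ) < T := by exact_mod_cast hT i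
    have hTN : (0 : ℝ) < T / N := div_pos hT0 hN0'
    have h1 : ((k j : ℕ) : ℝ) ≤ (k i : ℕ) + 1 := by exact_mod_cast hcon.1
    have h2 : ((k i : ℕ) : ℝ) ≤ (k j : ℕ) + 1 := by exact_mod_cast hcon.2
    have h3 : |x i - x j| ≤ 2 * (T / N) := by
      rw [abs_le]
      constructor <;> nlinarith [hk1 i, hk2 i, hk1 j, hk2 j]
    have h4 := hN i j hij
    have h5 : 2 * ((T : ℝ) / N) * N = 2 * T := by field_simp
    nlinarith
  · simp only [gridBox, Set.mem_Ioc, NNReal.coe_mul, NNReal.coe_add, NNReal.coe_div,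
      NNReal.coe_natCast, NNReal.coe_one]
    exact ⟨hk1 i, hk2 i⟩

theorem dist_corner_gridBox_le (hT : Fin n → 0 < T) {N : ℕ} {k : GridIndex n N} {x : Fin n → ℝ}
    (hk : x ∈ (gridBox hT k).toSet) : dist (gridBox hT k).corner x ≤ T / N := by
  rw [dist_pi_le_iff (by positivity)]
  intro i
  have h1 := hk i trivial
  simp only [gridBox, Set.mem_Ioc, NNReal.coe_mul, NNReal.coe_add, NNReal.coe_div,
    NNReal.coe_natCast, NNReal.coe_one] at h1
  simp only [OffDiagBox.corner, gridBox, NNReal.coe_mul, NNReal.coe_div, NNReal.coe_natCast]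
  rw [dist_comm, Real.dist_eq, abs_of_nonneg (by linarith [h1.1])]
  linarith [h1.2]

/-- A point off the diagonals eventually lies in a retained cell, whose corner tends to it. -/
theorem tendsto_eval_gridApprox (hT : Fin n → 0 < T) {h : (Fin n → ℝ) → ℝ} (hh : Continuous h)
    {x : Fin n → ℝ} (hx : ∀ i, x i ∈ Set.Ioc (0 : ℝ) T) (hxx : ∀ i j, i ≠ j → x i ≠ x j) :
    Tendsto (fun N => (gridApprox hT N h).eval x) atTop (𝓝 (h x)) := by
  rw [Metric.tendsto_nhds]
  intro δ hδ
  obtain ⟨ρ, hρ, hρ'⟩ := Metric.continuousAt_iff.1 hh.continuousAt δ hδ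
  have h1 : ∀ᶠ N : ℕ in atTop, (T : ℝ) / N < ρ :=
    (tendsto_const_div_atTop_nhds_zero_nat (T : ℝ)).eventually (gt_mem_nhds hρ)
  have h2 : ∀ᶠ N : ℕ in atTop, ∀ i j, i ≠ j → 2 * (T : ℝ) < |x i - x j| * N := by
    rw [eventually_all]
    intro i
    rw [eventually_all]
    intro j
    by_cases hij : i = j
    · simp [hij]
    · have : Tendsto (fun N : ℕ => |x i - x j| * (N : ℝ)) atTop atTop :=
        tendsto_natCast_atTop_atTop.const_mul_atTop (abs_pos.2 (sub_ne_zero.2 (hxx i j hij)))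
      filter_upwards [this.eventually_gt_atTop (2 * (T : ℝ))] with N hN _ using hN
  filter_upwards [h1, h2, eventually_gt_atTop 0] with N hN1 hN2 hN0
  obtain ⟨k, hk⟩ := exists_mem_gridBox hT hx hN2 hN0
  rw [eval_gridApprox_of_mem hT h hk]
  exact hρ' ((dist_corner_gridBox_le hT hk).trans_lt hN1)

theorem ae_coord_ne (i j : Fin n) (hij : i ≠ j) : ∀ᵐ x : Fin n → ℝ, x i ≠ x j := by
  let s : Submodule ℝ (Fin n → ℝ) :=
    LinearMap.ker ((LinearMap.proj i : (Fin n → ℝ) →ₗ[ℝ] ℝ) - LinearMap.proj j)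
  have hs : s ≠ ⊤ := by
    intro h
    have : (Pi.single i 1 : Fin n → ℝ) ∈ s := h ▸ Submodule.mem_top
    simp [s, Pi.single_eq_of_ne hij.symm] at this
  have h0 := Measure.addHaar_submodule volume s hs
  rw [ae_iff]
  refine measure_mono_null (fun x hx => ?_) h0
  simp only [ne_eq, not_not, Set.mem_ofPred_eq] at hx
  simp [s, hx]

theorem ae_coord_ne_zero (i : Fin n) : ∀ᵐ x : Fin n → ℝ, x i ≠ 0 := by
  let s : Submodule ℝ (Fin n → ℝ) := LinearMap.ker (LinearMap.proj i : (Fin n → ℝ) →ₗ[ℝ] ℝ)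
  have hs : s ≠ ⊤ := by
    intro h
    have : (Pi.single i 1 : Fin n → ℝ) ∈ s := h ▸ Submodule.mem_top
    simp [s] at this
  have h0 := Measure.addHaar_submodule volume s hs
  rw [ae_iff]
  refine measure_mono_null (fun x hx => ?_) h0
  simp only [ne_eq, not_not, Set.mem_ofPred_eq] at hx
  simp [s, hx]

theorem tendsto_eLpNorm_gridApprox_sub (hT : Fin n → 0 < T) {h : (Fin n → ℝ) → ℝ}
    (hh : Continuous h) (hc : HasCompactSupport h) :
    Tendsto (fun N => eLpNorm (fun x => (gridApprox hT N h).eval x - h x) 2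
      (volume.restrict (cube n T))) atTop (𝓝 0) := by
  obtain ⟨M, hM⟩ := hc.exists_bound_of_continuous hh
  have hM0 : 0 ≤ M := (norm_nonneg _).trans (hM 0)
  have hsq : Tendsto (fun N => eLpNorm (fun x => (gridApprox hT N h).eval x - h x) 2
      (volume.restrict (cube n T)) ^ 2) atTop (𝓝 0) := by
    simp_rw [eLpNorm_two_sq]
    have : (0 : ℝ≥0∞) = ∫⁻ x, 0 ∂(volume.restrict (cube n T)) := by simp
    rw [this]
    refine tendsto_lintegral_of_dominated_convergence (fun _ => ENNReal.ofReal ((2 * M) ^ 2))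
      (fun N => (((gridApprox hT N h).measurable_eval.sub hh.measurable).pow_const 2).ennreal_ofReal)
      (fun N => Eventually.of_forall fun x => ?_) ?_ ?_
    · refine ENNReal.ofReal_le_ofReal (sq_le_sq' ?_ ?_) <;>
        linarith [abs_le.1 (abs_eval_gridApprox_le hT N hM x), abs_le.1 (hM x)]
    · rw [lintegral_const]
      exact ENNReal.mul_ne_top ENNReal.ofReal_ne_top (measure_ne_top _ _)
    -- Convergence may fail only on diagonals, and on coordinate hyperplanes because cells are
    -- left-open. Both are proper subspaces, hence null.
    · have h1 : ∀ᵐ x ∂(volume.restrict (cube n T)), ∀ i j, i ≠ j → x i ≠ x j := by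
        refine ae_restrict_of_ae ?_
        simp_rw [ae_all_iff]
        exact fun i j hij => ae_coord_ne i j hij
      have h2 : ∀ᵐ x ∂(volume.restrict (cube n T)), ∀ i, x i ≠ 0 :=
        ae_restrict_of_ae (ae_all_iff.2 ae_coord_ne_zero)
      filter_upwards [h1, h2, ae_restrict_mem (measurableSet_cube n T)] with x hx1 hx2 hx3
      have hx : ∀ i, x i ∈ Set.Ioc (0 : ℝ) T := fun i =>
        ⟨lt_of_le_of_ne (hx3 i trivial).1 (hx2 i).symm, (hx3 i trivial).2⟩
      have hlim := tendsto_eval_gridApprox hT hh hx hx1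
      have hcont : Continuous fun y : ℝ => ENNReal.ofReal ((y - h x) ^ 2) :=
        ENNReal.continuous_ofReal.comp (by fun_prop)
      simpa [Function.comp_def] using (hcont.tendsto (h x)).comp hlim
  have h3 := (ENNReal.continuous_rpow_const (y := 1 / 2)).tendsto 0 |>.comp hsq
  have h4 : ∀ a : ℝ≥0∞, (a ^ 2) ^ (2⁻¹ : ℝ) = a := fun a => by
    rw [← ENNReal.rpow_natCast, ← ENNReal.rpow_mul]
    norm_num
  simpa [Function.comp_def, h4] using h3

/-- Off-diagonal simple functions are dense in `L²([0,T]^n)`. -/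
theorem exists_offDiagSimple_eLpNorm_sub_le {f : (Fin n → ℝ) → ℝ}
    (hf : MemLp f 2 (volume.restrict (cube n T))) {δ : ℝ≥0∞} (hδ : δ ≠ 0) :
    ∃ g : OffDiagSimple n T,
      eLpNorm (fun x => g.eval x - f x) 2 (volume.restrict (cube n T)) ≤ δ := by
  -- For `n = 0` this is vacuous and the grid has its single empty index. If it fails, then `n > 0`
  -- and `T = 0`, so the cube is null.
  by_cases hT : Fin n → 0 < T
  · have hF : MemLp ((cube n T).indicator f) 2 volume :=
      (memLp_indicator_iff_restrict (measurableSet_cube n T)).2 hf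
    obtain ⟨h, hc, hle, hh, -⟩ := hF.exists_hasCompactSupport_eLpNorm_sub_le (by norm_num)
      (ENNReal.half_pos hδ).ne'
    have hle' : eLpNorm (fun x => h x - f x) 2 (volume.restrict (cube n T)) ≤ δ / 2 := by
      refine le_trans ?_ hle
      rw [← eLpNorm_neg]
      refine le_trans (le_of_eq (eLpNorm_congr_ae ?_)) (eLpNorm_restrict_le _ 2 volume (cube n T))
      filter_upwards [ae_restrict_mem (measurableSet_cube n T)] with x hx
      simp [hx]
    obtain ⟨N, hN⟩ := ((tendsto_eLpNorm_gridApprox_sub hT hh hc).eventually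
      (ge_mem_nhds (ENNReal.half_pos hδ))).exists
    refine ⟨gridApprox hT N h, ?_⟩
    calc eLpNorm (fun x => (gridApprox hT N h).eval x - f x) 2 (volume.restrict (cube n T))
        = eLpNorm ((fun x => (gridApprox hT N h).eval x - h x) + fun x => h x - f x) 2
          (volume.restrict (cube n T)) := by
          congr 1
          ext x
          simp
      _ ≤ δ / 2 + δ / 2 := (eLpNorm_add_le
          ((gridApprox hT N h).measurable_eval.sub hh.measurable).aestronglyMeasurable
          (hh.aestronglyMeasurable.sub hf.1) one_le_two).trans (add_le_add hN hle')
      _ = δ := ENNReal.add_halves δ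
  · push Not at hT
    obtain ⟨i, hi⟩ := hT
    have hi : T = 0 := le_antisymm hi zero_le
    have h0 : (volume : Measure (Fin n → ℝ)).restrict (cube n T) = 0 := by
      rw [Measure.restrict_eq_zero, cube, volume_pi, Measure.pi_pi]
      exact Finset.prod_eq_zero (Finset.mem_univ i) (by simp [hi])
    exact ⟨OffDiagSimple.ofFintype (ι := Empty) Empty.elim Empty.elim, by rw [h0]; simp⟩

end Density

/-! ### Existence of the multiple Wiener–Itô integral. -/

section Existence

/-- Enlarging `k` to `k²` avoids a square root; only the finiteness of the constant matters later.
-/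
theorem le_natCast_mul_of_sq_le {a b : ℝ≥0∞} {k : ℕ} (h : a ^ 2 ≤ k * b ^ 2) :
    a ≤ k * b := by
  rw [← ENNReal.pow_le_pow_left_iff two_ne_zero, mul_pow]
  refine h.trans (mul_le_mul_left ?_ _)
  exact_mod_cast Nat.le_self_pow two_ne_zero k

variable {n : ℕ} {T : ℝ≥0}
  {Ω : Type*} [MeasurableSpace Ω] {P : Measure Ω} [IsProbabilityMeasure P]
  {Ω' : Type*} [MeasurableSpace Ω'] {P' : Measure Ω'} [IsProbabilityMeasure P']
  {ξ : ℕ → Ω → ℝ} {W : ℝ≥0 → Ω' → ℝ}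

/-- The multiple Wiener–Itô integral of a square integrable function exists. -/
theorem exists_isMultipleWienerIntegral (hξ : IsStandardIID ξ P) (hW : IsPreBrownianReal W P')
    {f : (Fin n → ℝ) → ℝ} (hf : MemLp f 2 (volume.restrict (cube n T))) :
    ∃ I : Ω' → ℝ, IsMultipleWienerIntegral W P' T f I := by
  have hex : ∀ k : ℕ, ∃ g : OffDiagSimple n T,
      eLpNorm (fun x => g.eval x - f x) 2 (volume.restrict (cube n T)) ≤ (k : ℝ≥0∞)⁻¹ := fun k =>
    exists_offDiagSimple_eLpNorm_sub_le hf (by simp)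
  choose g hg using hex
  have hg0 : Tendsto (fun k => eLpNorm (fun x => (g k).eval x - f x) 2
      (volume.restrict (cube n T))) atTop (𝓝 0) :=
    tendsto_of_tendsto_of_tendsto_of_le_of_le tendsto_const_nhds
      ENNReal.tendsto_inv_nat_nhds_zero (fun _ => zero_le) hg
  have hbound : ∀ s : OffDiagSimple n T, eLpNorm (s.integral W) 2 P' ≤
      (n ! : ℕ) * eLpNorm s.eval 2 (volume.restrict (cube n T)) := fun s =>
    le_natCast_mul_of_sq_le (s.eLpNorm_integral_le hξ hW)
  have hI : ∀ k, MemLp ((g k).integral W) 2 P' := fun k =>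
    ⟨((g k).aemeasurable_integral hW).aestronglyMeasurable, (hbound (g k)).trans_lt
      (ENNReal.mul_lt_top (ENNReal.natCast_lt_top _) ((g k).memLp_eval 2).2)⟩
  -- The moment bound applied to differences turns the convergence of `g k` to `f` into a Cauchy
  -- property of the integrals.
  have hcau : CauchySeq fun k => (hI k).toLp := by
    rw [Lp.cauchySeq_Lp_iff_cauchySeq_eLpNorm]
    have hlim : Tendsto (fun p : ℕ × ℕ => ((n ! : ℕ) : ℝ≥0∞) * ((p.1 : ℝ≥0∞)⁻¹ + (p.2 : ℝ≥0∞)⁻¹))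
        atTop (𝓝 0) := by
      rw [← prod_atTop_atTop_eq]
      have h1 := (ENNReal.tendsto_inv_nat_nhds_zero.comp (tendsto_fst (f := atTop) (g := atTop))).add
        (ENNReal.tendsto_inv_nat_nhds_zero.comp (tendsto_snd (f := atTop) (g := atTop)))
      simpa using ENNReal.Tendsto.const_mul h1 (Or.inr (ENNReal.natCast_ne_top (n !)))
    refine tendsto_of_tendsto_of_tendsto_of_le_of_le tendsto_const_nhds hlim
      (fun _ => zero_le) fun p => ?_
    calc eLpNorm (⇑(hI p.1).toLp - ⇑(hI p.2).toLp) 2 P'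
        = eLpNorm (((g p.1).sub (g p.2)).integral W) 2 P' := by
          refine eLpNorm_congr_ae ?_
          filter_upwards [(hI p.1).coeFn_toLp, (hI p.2).coeFn_toLp] with ω h1 h2
          rw [Pi.sub_apply, h1, h2, OffDiagSimple.integral_sub]
      _ ≤ _ := hbound _
      _ ≤ _ := by
          refine mul_le_mul_right ?_ _
          have hsub : ((g p.1).sub (g p.2)).eval =
              (fun x => (g p.1).eval x - f x) - fun x => (g p.2).eval x - f x := by
            ext x
            simp [OffDiagSimple.eval_sub]
          rw [hsub]
          exact (eLpNorm_sub_le ((g p.1).measurable_eval.aestronglyMeasurable.sub hf.1)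
            ((g p.2).measurable_eval.aestronglyMeasurable.sub hf.1) one_le_two).trans
            (add_le_add (hg _) (hg _))
  obtain ⟨J, hJ⟩ := cauchySeq_tendsto_of_complete hcau
  refine ⟨J, Lp.memLp J, g, hg0, ?_⟩
  rw [Lp.tendsto_Lp_iff_tendsto_eLpNorm'] at hJ
  refine hJ.congr fun k => eLpNorm_congr_ae ?_
  filter_upwards [(hI k).coeFn_toLp] with ω h1
  rw [Pi.sub_apply, h1]

end Existence

/-! ### Convergence in distribution through approximation in mean. -/

section Approximation

theorem abs_integral_map_sub_le {Ω E : Type*} [MeasurableSpace Ω] {P : Measure Ω}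
    [IsProbabilityMeasure P] [NormedAddCommGroup E] [MeasurableSpace E] [BorelSpace E]
    {X Y : Ω → E} (hX : AEMeasurable X P) (hY : AEMeasurable Y P) {F : E → ℝ} {L : ℝ≥0}
    (hF : LipschitzWith L F) {C : ℝ} (hC : ∀ x y, dist (F x) (F y) ≤ C) {δ : ℝ≥0}
    (h : ∫⁻ ω, ‖X ω - Y ω‖ₑ ∂P ≤ δ) :
    |∫ x, F x ∂(P.map X) - ∫ x, F x ∂(P.map Y)| ≤ L * δ := by
  have hFm : Measurable F := hF.continuous.measurable
  have hbound : ∀ x, ‖F x‖ ≤ ‖F 0‖ + C := fun x => by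
    have := hC x 0
    rw [dist_eq_norm] at this
    linarith [norm_sub_norm_le (F x) (F 0)]
  have hint : ∀ {Z : Ω → E}, AEMeasurable Z P → Integrable (fun ω => F (Z ω)) P := fun hZ =>
    Integrable.of_bound (hFm.comp_aemeasurable hZ).aestronglyMeasurable (‖F 0‖ + C)
      (Eventually.of_forall fun ω => hbound _)
  rw [integral_map hX hFm.aestronglyMeasurable, integral_map hY hFm.aestronglyMeasurable,
    ← integral_sub (hint hX) (hint hY)]
  have h1 : ‖∫ ω, (F (X ω) - F (Y ω)) ∂P‖ₑ ≤ ((L * δ : ℝ≥0) : ℝ≥0∞) := by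
    refine (enorm_integral_le_lintegral_enorm _).trans ?_
    calc ∫⁻ ω, ‖F (X ω) - F (Y ω)‖ₑ ∂P ≤ ∫⁻ ω, L * ‖X ω - Y ω‖ₑ ∂P :=
          lintegral_mono fun ω => by simpa only [edist_eq_enorm_sub] using hF (X ω) (Y ω)
      _ = L * ∫⁻ ω, ‖X ω - Y ω‖ₑ ∂P := lintegral_const_mul' _ _ ENNReal.coe_ne_top
      _ ≤ L * δ := by gcongr
      _ = _ := by push_cast; rfl
  rw [enorm_le_coe] at h1
  exact_mod_cast h1

/-- A process which is uniformly approximated in mean by processes converging in distribution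
converges in distribution. -/
theorem tendstoInDistribution_of_forall_approx {ι Ω Ω' E : Type*} [MeasurableSpace Ω]
    {P : Measure Ω} [IsProbabilityMeasure P] [MeasurableSpace Ω'] {P' : Measure Ω'}
    [IsProbabilityMeasure P'] [NormedAddCommGroup E] [MeasurableSpace E] [BorelSpace E]
    {l : Filter ι} [l.IsCountablyGenerated] {Y : ι → Ω → E} {Z : Ω' → E}
    (hY : ∀ i, AEMeasurable (Y i) P) (hZ : AEMeasurable Z P')
    (h : ∀ δ : ℝ≥0, 0 < δ → ∃ (X : ι → Ω → E) (V : Ω' → E),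
      TendstoInDistribution X l V (fun _ => P) P' ∧
      (∀ᶠ i in l, ∫⁻ ω, ‖Y i ω - X i ω‖ₑ ∂P ≤ δ) ∧ ∫⁻ ω, ‖V ω - Z ω‖ₑ ∂P' ≤ δ) :
    TendstoInDistribution Y l Z (fun _ => P) P' := by
  refine ⟨hY, hZ, tendsto_iff_forall_lipschitz_integral_tendsto.2 ?_⟩
  rintro F ⟨C, hC⟩ ⟨L, hL⟩
  rw [Metric.tendsto_nhds]
  intro η hη
  -- The three errors get `η / 3` each; `L + 1` keeps the denominator positive when `L = 0`.
  obtain ⟨δ, hδη⟩ : ∃ δ : ℝ≥0, (δ : ℝ) = η / (3 * (L + 1)) :=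
    ⟨Real.toNNReal _, Real.coe_toNNReal _ (by positivity)⟩
  obtain ⟨X, V, hXV, hYX, hVZ⟩ := h δ (NNReal.coe_pos.1 (by rw [hδη]; positivity))
  have hlim := tendsto_iff_forall_lipschitz_integral_tendsto.1 hXV.tendsto
  have hδ : (L : ℝ) * δ < η / 3 := by
    rw [hδη]
    have : (0 : ℝ) < L + 1 := by positivity
    rw [← mul_div_assoc, div_lt_div_iff₀ (by positivity) (by positivity)]
    nlinarith
  filter_upwards [hYX, Metric.tendsto_nhds.1 (hlim F ⟨C, hC⟩ ⟨L, hL⟩) (η / 3) (by positivity)]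
    with i hi1 hi2
  have h1 := abs_integral_map_sub_le (hY i) (hXV.forall_aemeasurable i) hL hC hi1
  have h2 := abs_integral_map_sub_le hXV.aemeasurable_limit hZ hL hC hVZ
  have h0 : |∫ x, F x ∂(P.map (X i)) - ∫ x, F x ∂(P'.map V)| < η / 3 := hi2
  change |∫ x, F x ∂(P.map (Y i)) - ∫ x, F x ∂(P'.map Z)| < η
  have h3 := abs_sub_le (∫ x, F x ∂(P.map (Y i))) (∫ x, F x ∂(P.map (X i)))
    (∫ x, F x ∂(P'.map Z))
  have h4 := abs_sub_le (∫ x, F x ∂(P.map (X i))) (∫ x, F x ∂(P'.map V))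
    (∫ x, F x ∂(P'.map Z))
  linarith

/-- The sup norm is at most the sum over coordinates, and `L¹` norms are at most `L²` norms on a
probability space. -/
theorem lintegral_enorm_pi_le {Ω : Type*} [MeasurableSpace Ω] {P : Measure Ω}
    [IsProbabilityMeasure P] {r : ℕ} {X : Ω → Fin r → ℝ} (hX : ∀ j, AEMeasurable (X · j) P)
    {c : ℝ≥0∞} (hc : ∀ j, eLpNorm (X · j) 2 P ≤ c) : ∫⁻ ω, ‖X ω‖ₑ ∂P ≤ r * c := by
  calc ∫⁻ ω, ‖X ω‖ₑ ∂P ≤ ∫⁻ ω, ∑ j, ‖X ω j‖ₑ ∂P := by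
        refine lintegral_mono fun ω => ?_
        have h : ‖X ω‖₊ ≤ ∑ j, ‖X ω j‖₊ := (pi_nnnorm_le_iff).2 fun j =>
          Finset.single_le_sum (f := fun j => ‖X ω j‖₊) (fun _ _ => zero_le) (Finset.mem_univ j)
        simp only [enorm_eq_nnnorm]
        exact_mod_cast h
    _ = ∑ j, ∫⁻ ω, ‖X ω j‖ₑ ∂P := lintegral_finsetSum' _ fun j _ => (hX j).enorm
    _ ≤ ∑ _j : Fin r, c := by
        refine Finset.sum_le_sum fun j _ => ?_
        rw [← eLpNorm_one_eq_lintegral_enorm]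
        exact (eLpNorm_le_eLpNorm_of_exponent_le one_le_two (hX j).aestronglyMeasurable).trans (hc j)
    _ = r * c := by simp

end Approximation

/-! ### Joint convergence for general square integrable functions. -/

section Convergence

variable {n : ℕ} {T : ℝ≥0}

theorem truncatedIntegral_sub {Ω : Type*} (ξ : ℕ → Ω → ℝ) (ε : ℝ) {f g : (Fin n → ℝ) → ℝ}
    (hf : IntegrableOn f (cube n T)) (hg : IntegrableOn g (cube n T)) (ω : Ω) :
    truncatedIntegral (donskerKernel ξ ε) ε (fun x => f x - g x) T ω =
      truncatedIntegral (donskerKernel ξ ε) ε f T ω -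
        truncatedIntegral (donskerKernel ξ ε) ε g T ω := by
  have h := integral_sub (integrable_truncatedIntegrand ξ ε hf ω)
    (integrable_truncatedIntegrand ξ ε hg ω)
  refine Eq.trans ?_ h
  refine integral_congr_ae (Eventually.of_forall fun x => ?_)
  simp only [separated]
  ring

/-- Moving `t` into the integrand turns finite-dimensional distributions in `t` into joint laws of
several integrals over one cube. -/
theorem truncatedIntegral_eq_indicator {Ω : Type*} (θ : ℝ → Ω → ℝ) (ε : ℝ)
    (f : (Fin n → ℝ) → ℝ) {t : ℝ≥0} (ht : t ≤ T) (ω : Ω) :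
    truncatedIntegral θ ε f t ω = truncatedIntegral θ ε ((cube n t).indicator f) T ω := by
  rw [truncatedIntegral, truncatedIntegral, ← Set.inter_eq_right.2 (cube_mono (n := n) ht),
    ← setIntegral_indicator (measurableSet_cube n t), Set.inter_eq_right.2 (cube_mono (n := n) ht)]
  congr with x
  by_cases hx : x ∈ cube n t <;> simp [hx]

variable {Ω : Type*} [MeasurableSpace Ω] {P : Measure Ω} [IsProbabilityMeasure P]
  {Ω' : Type*} [MeasurableSpace Ω'] {P' : Measure Ω'} [IsProbabilityMeasure P']
  {ξ : ℕ → Ω → ℝ} {W : ℝ≥0 → Ω' → ℝ}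

/-- Joint convergence in distribution of finitely many approximating multiple integrals. -/
theorem tendstoInDistribution_truncatedIntegral (hξ : IsStandardIID ξ P)
    (hW : IsPreBrownianReal W P') {r : ℕ} {F : Fin r → (Fin n → ℝ) → ℝ}
    (hF : ∀ j, MemLp (F j) 2 (volume.restrict (cube n T))) {J : Fin r → Ω' → ℝ}
    (hJ : ∀ j, IsMultipleWienerIntegral W P' T (F j) (J j)) :
    TendstoInDistribution
      (fun (ε : ℝ) ω j => truncatedIntegral (donskerKernel ξ ε) ε (F j) T ω) (𝓝[>] 0)
      (fun ω j => J j ω) (fun _ => P) P' := by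
  have hFi : ∀ j, IntegrableOn (F j) (cube n T) := fun j => (hF j).integrable one_le_two
  have hYm : ∀ ε j, AEMeasurable (truncatedIntegral (donskerKernel ξ ε) ε (F j) T) P := fun ε j =>
    aemeasurable_truncatedIntegral hξ.aemeasurable ε (hFi j)
  have hJm : ∀ j, AEMeasurable (J j) P' := fun j => (hJ j).1.1.aemeasurable
  refine tendstoInDistribution_of_forall_approx (fun ε => aemeasurable_pi_lambda _ (hYm ε))
    (aemeasurable_pi_lambda _ hJm) fun δ hδ => ?_
  -- Chosen so that both `r * n! * δ'` and `r * δ'` are at most `δ`; the `1` covers `r = 0`.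
  set δ' : ℝ≥0 := δ / (r * n ! + 1) with hδ'
  have hδ'0 : 0 < δ' := by positivity
  have hδ'1 : (r : ℝ≥0) * (n ! * δ') ≤ δ := by
    calc (r : ℝ≥0) * (n ! * δ') ≤ (r * n ! + 1) * δ' := by rw [← mul_assoc]; gcongr; simp
      _ = δ := mul_div_cancel₀ _ (by positivity)
  have hδ'2 : (r : ℝ≥0) * δ' ≤ δ := by
    refine le_trans ?_ hδ'1
    gcongr
    exact le_mul_of_one_le_left zero_le (by exact_mod_cast Nat.factorial_pos n)
  have hδ'e : (0 : ℝ≥0∞) < δ' := by exact_mod_cast hδ'0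
  have hex : ∀ j, ∃ g : OffDiagSimple n T,
      eLpNorm (fun x => g.eval x - F j x) 2 (volume.restrict (cube n T)) ≤ δ' ∧
      eLpNorm (fun ω => g.integral W ω - J j ω) 2 P' ≤ δ' := fun j => by
    -- The defining sequence of `J j` makes one simple function close to `F j` and its integral
    -- close to `J j` at once, so any version of the integral will do.
    obtain ⟨-, g, hg1, hg2⟩ := hJ j
    obtain ⟨k, hk⟩ := ((hg1.eventually (ge_mem_nhds hδ'e)).and
      (hg2.eventually (ge_mem_nhds hδ'e))).exists
    exact ⟨g k, hk⟩
  choose g hg1 hg2 using hex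
  refine ⟨_, _, tendstoInDistribution_integral_simple hξ hW g, ?_, ?_⟩
  · filter_upwards [eventually_all.2 fun j => (g j).eventually_truncatedIntegral_eq ξ,
      self_mem_nhdsWithin, nhdsWithin_le_nhds (ge_mem_nhds (zero_lt_one' ℝ))] with ε hε hε0 hε1
    have hgi : ∀ j, IntegrableOn (g j).eval (cube n T) := fun j =>
      ((g j).memLp_eval 1).integrable le_rfl
    have hsub : ∀ j, (fun ω => truncatedIntegral (donskerKernel ξ ε) ε (F j) T ω -
        (g j).integral (donskerWalk ξ ε) ω) =
        truncatedIntegral (donskerKernel ξ ε) ε (fun x => F j x - (g j).eval x) T := fun j => by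
      ext ω
      rw [truncatedIntegral_sub ξ ε (hFi j) (hgi j), hε j ω]
    refine (lintegral_enorm_pi_le (c := (n ! * δ' : ℝ≥0)) (fun j => ?_) fun j => ?_).trans
      (by exact_mod_cast hδ'1)
    · simp only [Pi.sub_apply]
      rw [hsub j]
      exact aemeasurable_truncatedIntegral hξ.aemeasurable ε ((hFi j).sub (hgi j))
    · simp only [Pi.sub_apply]
      rw [hsub j]
      refine (le_natCast_mul_of_sq_le (eLpNorm_truncatedIntegral_le hξ
        ((hF j).sub ((g j).memLp_eval 2)) hε0 hε1)).trans ?_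
      push_cast
      gcongr
      rw [← eLpNorm_neg]
      refine le_trans (le_of_eq ?_) (hg1 j)
      congr 1
      ext x
      simp
  · refine (lintegral_enorm_pi_le (c := δ') (fun j => ?_) hg2).trans (by exact_mod_cast hδ'2)
    exact ((g j).aemeasurable_integral hW).sub (hJm j)

end Convergence

end DonskerWiener

end

/-! ### The main theorem. -/

open DonskerWiener in
theorem mainTheorem3
    {Ω : Type*} [MeasurableSpace Ω] (P : Measure Ω) [IsProbabilityMeasure P]
    {Ω' : Type*} [MeasurableSpace Ω'] (P' : Measure Ω') [IsProbabilityMeasure P']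
    (ξ : ℕ → Ω → ℝ) (hindep : iIndepFun ξ P) (hident : ∀ k, IdentDistrib (ξ k) (ξ 0) P P)
    (hL2 : MemLp (ξ 0) 2 P) (hmean : ∫ ω, ξ 0 ω ∂P = 0) (hvar : variance (ξ 0) P = 1)
    (W : ℝ≥0 → Ω' → ℝ) (hW : IsBrownianReal W P')
    (n : ℕ) (T : ℝ≥0) (f : (Fin n → ℝ) → ℝ) (hf : MemLp f 2 (volume.restrict (cube n T))) :
    -- the second moments are bounded, uniformly in `ε` and `t`
    (∀ ε : ℝ, 0 < ε → ε ≤ 1 → ∀ t : ℝ≥0, t ≤ T →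
      MemLp (truncatedIntegral (donskerKernel ξ ε) ε f t) 2 P ∧
      ∫ ω, (truncatedIntegral (donskerKernel ξ ε) ε f t ω) ^ 2 ∂P ≤
        (n ! : ℝ) * ∫ x in cube n T, (f x) ^ 2) ∧
    -- the multiple Wiener–Itô integral process `t ↦ I_n(f 1_{[0,t]^n})` exists
    (∃ I : ℝ≥0 → Ω' → ℝ, ∀ t : ℝ≥0, t ≤ T →
      IsMultipleWienerIntegral W P' T ((cube n t).indicator f) (I t)) ∧
    -- and the finite-dimensional distributions converge to those of any version of it
    (∀ I : ℝ≥0 → Ω' → ℝ,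
      (∀ t : ℝ≥0, t ≤ T → IsMultipleWienerIntegral W P' T ((cube n t).indicator f) (I t)) →
      ∀ (r : ℕ) (t : Fin r → ℝ≥0), (∀ i, t i ≤ T) →
        TendstoInDistribution
          (fun (ε : ℝ) (ω : Ω) (i : Fin r) =>
            truncatedIntegral (donskerKernel ξ ε) ε f (t i) ω)
          (𝓝[>] (0 : ℝ)) (fun (ω : Ω') (i : Fin r) => I (t i) ω) (fun _ => P) P') := by
  have hξ := isStandardIID hindep hident hL2 hmean hvar
  have hpre := hW.toIsPreBrownianReal
  have hind : ∀ t : ℝ≥0, MemLp ((cube n t).indicator f) 2 (volume.restrict (cube n T)) := fun t =>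
    hf.indicator (measurableSet_cube n t)
  refine ⟨fun ε hε hε1 t ht => memLp_and_integral_sq_truncatedIntegral_le hξ.indep hξ.memLp
    hξ.mean hξ.sq hf hε hε1 ht, ?_, fun I hI r t ht => ?_⟩
  · choose I hI using fun t => exists_isMultipleWienerIntegral hξ hpre (hind t)
    exact ⟨I, fun t _ => hI t⟩
  · simp_rw [fun ε ω i => truncatedIntegral_eq_indicator (donskerKernel ξ ε) ε f (ht i) ω]
    exact tendstoInDistribution_truncatedIntegral hξ hpre (fun i => hind (t i))
      fun i => hI (t i) (ht i)
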